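/- There exists a real number $\varepsilon>0$ with the following property. Let $G$ be a finite simple planar graph that contains no cycle of length $4$ (as a not necessarily induced subgraph), and let $L$ be a list assignment for $G$ that assigns to each vertex $v\in V(G)$ a set $L(v)$ of exactly five colors. Then $G$ with $L$ is weighted $\varepsilon$-flexible, that is: for every function $w$ that assigns a nonnegative real number $w(v,c)$ to each pair $(v,c)$ with $v\in V(G)$ and $c\in L(v)$, there is a proper coloring $\varphi$ of $G$ with $\varphi(v)\in L(v)$ for all $v\in V(G)$ such that \[ \sum_{v\in V(G)} w(v,\varphi(v))\ \ge\ \varepsilon\cdot\sum_{v\in V(G)}\ \sum_{c\in L(v)} w(v,c). \] -/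

import Mathlib

namespace Flexibility

open scoped BigOperators

universe u v

/-- A drawing of a simple graph in the Euclidean plane: vertices are distinct points, every edge
is a simple (continuous, not self-intersecting) arc joining its two ends, no arc passes through a
vertex other than its ends, and two different arcs share only the points of common ends. -/
structure PlaneDrawing {V : Type u} (G : SimpleGraph V) where
  /-- the point representing a vertex -/
  point : V → EuclideanSpace ℝ (Fin 2)
  /-- the set of points of the arc representing an edge (irrelevant for non-edges) -/
  arc : Sym2 V → Set (EuclideanSpace ℝ (Fin 2))
  point_injective : Function.Injective point
  arc_eq : ∀ x y : V, G.Adj x y →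
    ∃ γ : Path (point x) (point y), Function.Injective γ ∧ Set.range γ = arc s(x, y)
  vertex_on_arc : ∀ e ∈ G.edgeSet, ∀ x : V, point x ∈ arc e → x ∈ e
  arc_inter_arc : ∀ e ∈ G.edgeSet, ∀ f ∈ G.edgeSet, e ≠ f →
    ∀ p ∈ arc e ∩ arc f, ∃ x : V, x ∈ e ∧ x ∈ f ∧ p = point x

/-- A graph is planar if it has a drawing in the plane without crossings. -/
def IsPlanar {V : Type u} (G : SimpleGraph V) : Prop := Nonempty (PlaneDrawing G)

/-- `G` has no (not necessarily induced) cycle of length four. -/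
def NoFourCycle {V : Type u} (G : SimpleGraph V) : Prop :=
  ∀ (x : V) (p : G.Walk x x), p.IsCycle → p.length ≠ 4

/-- `φ` is an `L`-coloring: a proper coloring with every color taken from the list of its vertex. -/
def IsListColoring {V : Type u} {C : Type v} (G : SimpleGraph V) (L : V → Finset C)
    (φ : V → C) : Prop :=
  (∀ x y : V, G.Adj x y → φ x ≠ φ y) ∧ ∀ x : V, φ x ∈ L x

/-- A weighted request gives a nonnegative real to each pair `(x, c)` with `c ∈ L x`; the values
of `w` at other pairs are never used. -/
def IsWeightedRequest {V : Type u} {C : Type v} (L : V → Finset C) (w : V → C → ℝ) : Prop :=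
  ∀ x : V, ∀ c ∈ L x, 0 ≤ w x c

/-- The total weight `w(G, L)` of a request. -/
def totalWeight {V : Type u} {C : Type v} [Fintype V] (L : V → Finset C) (w : V → C → ℝ) : ℝ :=
  ∑ x : V, ∑ c ∈ L x, w x c

/-- A weighted request is `ε`-satisfiable if some `L`-coloring collects at least an `ε`-fraction
of the total weight. -/
def IsSatisfiable {V : Type u} {C : Type v} [Fintype V] (G : SimpleGraph V) (L : V → Finset C)
    (ε : ℝ) (w : V → C → ℝ) : Prop :=
  ∃ φ : V → C, IsListColoring G L φ ∧ ε * totalWeight L w ≤ ∑ x : V, w x (φ x)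

/-- `G` with the list assignment `L` is weighted `ε`-flexible. -/
def WeightedFlexible {V : Type u} {C : Type v} [Fintype V] (G : SimpleGraph V)
    (L : V → Finset C) (ε : ℝ) : Prop :=
  ∀ w : V → C → ℝ, IsWeightedRequest L w → IsSatisfiable G L ε w

end Flexibility

/-! The colorings are drawn at random, by peeling off small reducible sets. Every nonempty vertex
set `Z` induces a subgraph that has a vertex of degree at most 3 or a triangle whose vertices all
have degree 4. Either one is a set `H` such that every proper list coloring of `Z \ H` extends to
`H` with room to spare (`Reducible`). Color `Z \ H` recursively, then choose an extension from a
list of 125 = 5 ^ 3 entries containing every possible extension. The invariant `HasSample` says that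
up to three neighbors of a vertex outside `Z` all avoid a given color with probability at least 125
^ (-number of them). A vertex of `H` has at most three neighbors in `Z \ H`. With probability at
least 125 ^ (-3) they avoid a prescribed color, and one further choice then gives the vertex that
color. Hence each color of each list appears with probability at least 125 ^ (-4), and averaging the
weight over the sample finishes the proof.

The light configurations come from the bound 3|E| + 5 ≤ 5|V| + 2·#triangles
(`HasDoubleCover.edge_bound`) and discharging (`exists_light_configuration`). In place of Euler's
formula, the bound uses the easy half of MacLane's criterion: the cycle space modulo two is spanned
by face boundaries, which cover each edge at most twice. To avoid the Jordan curve theorem, the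
drawing is replaced by a minor model in the integer grid (`PlaneDrawing.exists_gridModel`), where a
closed chain is the boundary of a set of cells by explicit summation (`exists_cell_potential`). -/

namespace Flexibility

open scoped Classical

universe u v

/-! ### Edge density and discharging in graphs without four-cycles -/

section Density

variable {V : Type u}

/-- Adjacency formulation of having no four-cycle. -/
def FourCycleFree (G : SimpleGraph V) : Prop :=
  ∀ a b c d : V, a ≠ c → b ≠ d → G.Adj a b → G.Adj b c → G.Adj c d → ¬ G.Adj d a

theorem NoFourCycle.fourCycleFree {G : SimpleGraph V} (h : NoFourCycle G) : FourCycleFree G := by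
  intro a b c d hac hbd hab hbc hcd hda
  refine h a (.cons hab (.cons hbc (.cons hcd (.cons hda .nil)))) ?_ rfl
  have h1 := hab.ne
  have h2 := hbc.ne
  have h3 := hcd.ne
  have h4 := hda.ne
  rw [SimpleGraph.Walk.cons_isCycle_iff, SimpleGraph.Walk.isPath_def]
  simp
  grind

theorem FourCycleFree.induce {G : SimpleGraph V} (h : FourCycleFree G) (s : Set V) :
    FourCycleFree (G.induce s) := by
  intro a b c d hac hbd hab hbc hcd hda
  exact h a b c d (fun e => hac (Subtype.ext e)) (fun e => hbd (Subtype.ext e)) hab hbc hcd hda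

/-- An edge set is even if every vertex lies in an even number of its members. -/
def EvenEdges (S : Finset (Sym2 V)) : Prop := ∀ x : V, Even (S.filter (x ∈ ·)).card

theorem EvenEdges.exists_other {S : Finset (Sym2 V)} (hS : EvenEdges S) {a b : V}
    (hab : s(a, b) ∈ S) : ∃ c, c ≠ b ∧ s(a, c) ∈ S := by
  have hmem : s(a, b) ∈ S.filter (a ∈ ·) := by simp [hab]
  have hpos : 0 < (S.filter (a ∈ ·)).card := Finset.card_pos.2 ⟨_, hmem⟩
  have h1 : 1 < (S.filter (a ∈ ·)).card := by
    obtain ⟨k, hk⟩ := hS a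
    omega
  obtain ⟨e, he, hne⟩ := Finset.exists_mem_ne h1 s(a, b)
  obtain ⟨heS, hae⟩ := Finset.mem_filter.1 he
  obtain ⟨c, rfl⟩ := Sym2.mem_iff_exists.1 hae
  exact ⟨c, fun h => hne (by rw [h]), heS⟩

theorem evenEdges_triangle {a b c : V} (hab : a ≠ b) (hac : a ≠ c) (hbc : b ≠ c) :
    EvenEdges ({s(a, b), s(a, c), s(b, c)} : Finset (Sym2 V)) := by
  intro x
  by_cases ha : x = a
  · subst ha
    have : ({s(x, b), s(x, c), s(b, c)} : Finset (Sym2 V)).filter (x ∈ ·) = {s(x, b), s(x, c)} := by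
      ext e; simp only [Finset.mem_filter, Finset.mem_insert, Finset.mem_singleton]; grind
    rw [this, Finset.card_pair (by grind)]
    exact even_two
  by_cases hb : x = b
  · subst hb
    have : ({s(a, x), s(a, c), s(x, c)} : Finset (Sym2 V)).filter (x ∈ ·) = {s(a, x), s(x, c)} := by
      ext e; simp only [Finset.mem_filter, Finset.mem_insert, Finset.mem_singleton]; grind
    rw [this, Finset.card_pair (by grind)]
    exact even_two
  by_cases hc : x = c
  · subst hc
    have : ({s(a, b), s(a, x), s(b, x)} : Finset (Sym2 V)).filter (x ∈ ·) = {s(a, x), s(b, x)} := by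
      ext e; simp only [Finset.mem_filter, Finset.mem_insert, Finset.mem_singleton]; grind
    rw [this, Finset.card_pair (by grind)]
    exact even_two
  · have : ({s(a, b), s(a, c), s(b, c)} : Finset (Sym2 V)).filter (x ∈ ·) = ∅ := by
      ext e; simp only [Finset.mem_filter, Finset.mem_insert, Finset.mem_singleton]; grind
    simp [this]

theorem EvenEdges.sdiff {S T : Finset (Sym2 V)} (hS : EvenEdges S) (hT : EvenEdges T)
    (hTS : T ⊆ S) : EvenEdges (S \ T) := by
  intro x
  have h : ((S \ T).filter (x ∈ ·)).card + (T.filter (x ∈ ·)).card = (S.filter (x ∈ ·)).card := by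
    rw [← Finset.card_union_of_disjoint, ← Finset.filter_union, Finset.sdiff_union_of_subset hTS]
    exact Finset.disjoint_filter_filter Finset.sdiff_disjoint
  have h1 := hS x
  have h2 := hT x
  rw [← h, Nat.even_add] at h1
  exact h1.2 h2

theorem EvenEdges.three_le_card {G : SimpleGraph V} {S : Finset (Sym2 V)} (hS : EvenEdges S)
    (hG : ∀ e ∈ S, e ∈ G.edgeSet) (hne : S.Nonempty) : 3 ≤ S.card := by
  obtain ⟨e, he⟩ := hne
  induction e using Sym2.ind with
  | _ a b =>
    have hab : a ≠ b := (show G.Adj a b from hG _ he).ne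
    obtain ⟨c, hcb, hac⟩ := hS.exists_other he
    obtain ⟨d, hda, hbd⟩ := hS.exists_other (Sym2.eq_swap ▸ he : s(b, a) ∈ S)
    have h3 : ({s(a, b), s(a, c), s(b, d)} : Finset (Sym2 V)).card = 3 := by
      rw [Finset.card_eq_three]
      exact ⟨_, _, _, by grind, by grind, by grind, rfl⟩
    rw [← h3]
    apply Finset.card_le_card
    intro e he'
    simp only [Finset.mem_insert, Finset.mem_singleton] at he'
    rcases he' with rfl | rfl | rfl <;> assumption

/-- In a graph without four-cycles, a nonempty even edge set is a triangle or has at least five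
edges. -/
theorem EvenEdges.triangle_or_five_le {G : SimpleGraph V} (hC : FourCycleFree G)
    {S : Finset (Sym2 V)} (hS : EvenEdges S) (hG : ∀ e ∈ S, e ∈ G.edgeSet) (hne : S.Nonempty) :
    (∃ a b c, G.Adj a b ∧ G.Adj a c ∧ G.Adj b c ∧ S = {s(a, b), s(a, c), s(b, c)}) ∨
      5 ≤ S.card := by
  obtain ⟨e, he⟩ := hne
  induction e using Sym2.ind with
  | _ a b =>
    have hadj : G.Adj a b := hG _ he
    obtain ⟨c, hcb, hac⟩ := hS.exists_other he
    obtain ⟨d, hda, hbd⟩ := hS.exists_other (Sym2.eq_swap ▸ he : s(b, a) ∈ S)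
    have hadjc : G.Adj a c := hG _ hac
    have hadjd : G.Adj b d := hG _ hbd
    have n1 := hadj.ne
    have n2 := hadjc.ne
    have n3 := hadjd.ne
    by_cases hcd : c = d
    · subst hcd
      by_cases hT : S = {s(a, b), s(a, c), s(b, c)}
      · exact Or.inl ⟨a, b, c, hadj, hadjc, hadjd, hT⟩
      · right
        have hTS : ({s(a, b), s(a, c), s(b, c)} : Finset (Sym2 V)) ⊆ S := by
          intro e he'
          simp only [Finset.mem_insert, Finset.mem_singleton] at he'
          rcases he' with rfl | rfl | rfl <;> assumption
        have h3 : ({s(a, b), s(a, c), s(b, c)} : Finset (Sym2 V)).card = 3 := by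
          rw [Finset.card_eq_three]
          exact ⟨_, _, _, by grind, by grind, by grind, rfl⟩
        -- What remains after removing the triangle is even and nonempty, so it has at least three
        -- more edges.
        have hE := hS.sdiff (evenEdges_triangle n1 n2 n3) hTS
        have := hE.three_le_card (G := G) (fun e he' => hG e (Finset.mem_sdiff.1 he').1)
          (Finset.sdiff_nonempty.2 fun h => hT (h.antisymm hTS))
        rw [Finset.card_sdiff_of_subset hTS, h3] at this
        omega
    · right
      obtain ⟨g, hga, hcg⟩ := hS.exists_other (Sym2.eq_swap ▸ hac : s(c, a) ∈ S)
      obtain ⟨h, hhb, hdh⟩ := hS.exists_other (Sym2.eq_swap ▸ hbd : s(d, b) ∈ S)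
      have hadjg : G.Adj c g := hG _ hcg
      -- If `g = d`, then a, b, d, c would be a four-cycle; so the edges continuing at `c` and `d`
      -- are new and distinct.
      have hgd : g ≠ d := by
        rintro rfl
        exact hC a b g c hda.symm hcb.symm hadj hadjd hadjg.symm hadjc.symm
      have h5 : ({s(a, b), s(a, c), s(b, d), s(c, g), s(d, h)} : Finset (Sym2 V)).card = 5 := by
        rw [Finset.card_insert_of_notMem, Finset.card_insert_of_notMem,
          Finset.card_insert_of_notMem, Finset.card_pair] <;>
        grind
      rw [← h5]
      apply Finset.card_le_card
      intro e he'
      simp only [Finset.mem_insert, Finset.mem_singleton] at he'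
      rcases he' with rfl | rfl | rfl | rfl | rfl <;> assumption

/-- A family of even edge sets covering every edge at most twice, as large as the cycle space. -/
def HasDoubleCover (G : SimpleGraph V) [Fintype V] : Prop :=
  ∃ F : Finset (Finset (Sym2 V)), G.edgeFinset.card + 1 ≤ F.card + Fintype.card V ∧
    (∀ S ∈ F, S.Nonempty ∧ (∀ e ∈ S, e ∈ G.edgeSet) ∧ EvenEdges S) ∧
    ∀ e, (F.filter (e ∈ ·)).card ≤ 2

/-- Double counting: the members of the family have total size at most 2|E|. A member has at least 5
edges unless it is a triangle, which falls short by 2, so 5(|E| - |V| + 1) ≤ 2|E| + 2·#triangles. -/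
theorem HasDoubleCover.edge_bound [Fintype V] {G : SimpleGraph V} (hC : FourCycleFree G)
    (h : HasDoubleCover G) :
    3 * G.edgeFinset.card + 5 ≤ 5 * Fintype.card V + 2 * (G.cliqueFinset 3).card := by
  obtain ⟨F, hcard, hF, htwo⟩ := h
  have hsum : ∑ S ∈ F, S.card ≤ 2 * G.edgeFinset.card := by
    have h1 : ∀ S ∈ F, S.card = ∑ e ∈ G.edgeFinset, if e ∈ S then 1 else 0 := by
      intro S hS
      rw [Finset.sum_ite_mem, Finset.inter_eq_right.2, Finset.sum_const, smul_eq_mul, mul_one]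
      intro e he
      exact SimpleGraph.mem_edgeFinset.2 ((hF S hS).2.1 e he)
    rw [Finset.sum_congr rfl h1, Finset.sum_comm, mul_comm, ← smul_eq_mul, ← Finset.sum_const]
    apply Finset.sum_le_sum
    intro e _
    rw [← Finset.sum_filter, Finset.sum_const, smul_eq_mul, mul_one]
    exact htwo e
  let f : Finset V → Finset (Sym2 V) := fun T => T.sym2.filter fun e => ¬ e.IsDiag
  have htri : (F.filter fun S => S.card < 5).card ≤ (G.cliqueFinset 3).card := by
    refine (Finset.card_le_card ?_).trans (Finset.card_image_le (f := f))
    intro S hS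
    obtain ⟨hSF, hlt⟩ := Finset.mem_filter.1 hS
    obtain ⟨hne, hsub, hev⟩ := hF S hSF
    rcases hev.triangle_or_five_le hC hsub hne with ⟨a, b, c, hab, hac, hbc, rfl⟩ | h5
    · refine Finset.mem_image.2 ⟨{a, b, c}, ?_, ?_⟩
      · rw [SimpleGraph.mem_cliqueFinset_iff, SimpleGraph.is3Clique_iff]
        exact ⟨a, b, c, hab, hac, hbc, rfl⟩
      · have n1 := hab.ne
        have n2 := hac.ne
        have n3 := hbc.ne
        ext e
        induction e using Sym2.ind with
        | _ x y =>
          simp only [f, Finset.mem_filter, Finset.mk_mem_sym2_iff, Finset.mem_insert,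
            Finset.mem_singleton, Sym2.mk_isDiag_iff]
          grind
    · omega
  have hlow : 5 * F.card ≤ ∑ S ∈ F, S.card + 2 * (F.filter fun S => S.card < 5).card := by
    rw [Finset.card_filter, Finset.mul_sum, ← Finset.sum_add_distrib, mul_comm, ← smul_eq_mul,
      ← Finset.sum_const]
    apply Finset.sum_le_sum
    intro S hS
    obtain ⟨hne, hsub, hev⟩ := hF S hS
    have := hev.three_le_card hsub hne
    split_ifs <;> omega
  omega

/-- Two triangles sharing an edge contain a four-cycle, so the triangles at `x` use disjoint pairs
of neighbors. -/
theorem two_mul_card_triangles_le_degree [Fintype V] {G : SimpleGraph V} (hC : FourCycleFree G)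
    (x : V) : 2 * ((G.cliqueFinset 3).filter (x ∈ ·)).card ≤ G.degree x := by
  have hd : Set.PairwiseDisjoint (((G.cliqueFinset 3).filter (x ∈ ·) : Finset (Finset V)) :
      Set (Finset V)) (fun T => T.erase x) := by
    intro T hT T' hT' hne
    simp only [Finset.coe_filter, Set.mem_ofPred_eq, SimpleGraph.mem_cliqueFinset_iff] at hT hT'
    rw [Function.onFun, Finset.disjoint_left]
    intro y hy hy'
    apply hne
    have key : ∀ T : Finset V, G.IsNClique 3 T → x ∈ T → y ∈ T.erase x →
        ∃ w, G.Adj x w ∧ G.Adj y w ∧ G.Adj x y ∧ T = {x, y, w} := by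
      intro T hT hx hy
      obtain ⟨a, b, c, hab, hac, hbc, rfl⟩ := SimpleGraph.is3Clique_iff.1 hT
      have := hab.symm
      have := hac.symm
      have := hbc.symm
      simp only [Finset.mem_erase, Finset.mem_insert, Finset.mem_singleton] at hx hy
      rcases hx with rfl | rfl | rfl <;> rcases hy with ⟨hn, rfl | rfl | rfl⟩ <;>
        first
        | exact absurd rfl hn
        | exact ⟨a, by assumption, by assumption, by assumption, by grind⟩
        | exact ⟨b, by assumption, by assumption, by assumption, by grind⟩
        | exact ⟨c, by assumption, by assumption, by assumption, by grind⟩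
    obtain ⟨w, h1, h2, h3, rfl⟩ := key T hT.1 hT.2 hy
    obtain ⟨w', h1', h2', h3', rfl⟩ := key T' hT'.1 hT'.2 hy'
    by_cases hw : w = w'
    · rw [hw]
    · exact absurd h1'.symm (hC x w y w' h3.ne hw h1 h2.symm h2')
  rw [← SimpleGraph.card_neighborFinset_eq_degree, mul_comm, ← smul_eq_mul, ← Finset.sum_const]
  calc _ = ∑ T ∈ (G.cliqueFinset 3).filter (x ∈ ·), (T.erase x).card := by
        apply Finset.sum_congr rfl
        intro T hT
        obtain ⟨hT, hx⟩ := Finset.mem_filter.1 hT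
        rw [Finset.card_erase_of_mem hx, (SimpleGraph.mem_cliqueFinset_iff.1 hT).card_eq]
    _ = _ := (Finset.card_biUnion hd).symm
    _ ≤ _ := by
        apply Finset.card_le_card
        intro y hy
        obtain ⟨T, hT, hy⟩ := Finset.mem_biUnion.1 hy
        obtain ⟨hT, hx⟩ := Finset.mem_filter.1 hT
        obtain ⟨hn, hy⟩ := Finset.mem_erase.1 hy
        rw [SimpleGraph.mem_neighborFinset]
        exact (SimpleGraph.mem_cliqueFinset_iff.1 hT).isClique hx hy hn.symm

/-- The discharging argument: a vertex of degree four pays `3` and any other vertex pays `6` for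
each of its triangles. -/
theorem exists_light_configuration [Fintype V] {G : SimpleGraph V} (hC : FourCycleFree G)
    (hB : 3 * G.edgeFinset.card + 5 ≤ 5 * Fintype.card V + 2 * (G.cliqueFinset 3).card) :
    (∃ x, G.degree x ≤ 3) ∨ ∃ a b c, G.Adj a b ∧ G.Adj a c ∧ G.Adj b c ∧
      G.degree a = 4 ∧ G.degree b = 4 ∧ G.degree c = 4 := by
  by_contra! hcon
  obtain ⟨hdeg, htri⟩ := hcon
  let pay : V → ℕ := fun x => if G.degree x = 4 then 3 else 6
  have hpay : ∀ x, 3 ≤ pay x := by intro x; simp only [pay]; split_ifs <;> omega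
  -- Some vertex of each triangle has degree at least 5, so a triangle collects at least 3 + 3 + 6.
  have h1 : 12 * (G.cliqueFinset 3).card ≤ ∑ T ∈ G.cliqueFinset 3, ∑ x ∈ T, pay x := by
    rw [mul_comm, ← smul_eq_mul, ← Finset.sum_const]
    apply Finset.sum_le_sum
    intro T hT
    obtain ⟨a, b, c, hab, hac, hbc, rfl⟩ :=
      SimpleGraph.is3Clique_iff.1 (SimpleGraph.mem_cliqueFinset_iff.1 hT)
    rw [Finset.sum_insert (by simp [hab.ne, hac.ne]), Finset.sum_pair hbc.ne]
    have := htri a b c hab hac hbc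
    simp only [pay]
    split_ifs <;> omega
  have h2 : ∑ T ∈ G.cliqueFinset 3, ∑ x ∈ T, pay x =
      ∑ x, pay x * ((G.cliqueFinset 3).filter (x ∈ ·)).card := by
    have : ∀ T : Finset V, ∑ x ∈ T, pay x = ∑ x, if x ∈ T then pay x else 0 := by
      intro T; simp
    simp_rw [this]
    rw [Finset.sum_comm]
    apply Finset.sum_congr rfl
    intro x _
    rw [← Finset.sum_filter, Finset.sum_const, smul_eq_mul, mul_comm]
  -- Per vertex of degree d: 3·2 + 30 = 9·4 when d = 4, and 6·(d/2) + 30 ≤ 9d when d ≥ 5.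
  have h3 : ∑ x, pay x * ((G.cliqueFinset 3).filter (x ∈ ·)).card + 30 * Fintype.card V ≤
      9 * ∑ x, G.degree x := by
    rw [← Finset.card_univ, mul_comm 30, ← smul_eq_mul (a := Finset.card _), ← Finset.sum_const,
      ← Finset.sum_add_distrib, Finset.mul_sum]
    apply Finset.sum_le_sum
    intro x _
    have ht := two_mul_card_triangles_le_degree hC x
    have hd := hdeg x
    simp only [pay]
    split_ifs <;> omega
  -- Now 12T + 30|V| ≤ 18|E|, while six times `hB` gives 18|E| + 30 ≤ 30|V| + 12T.
  rw [SimpleGraph.sum_degrees_eq_twice_card_edges] at h3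
  omega

end Density

/-! ### Chains modulo two on the integer grid -/

section Grid

/-- The four neighbours of a point of the integer grid. -/
def gridNeighbors (p : ℤ × ℤ) : Finset (ℤ × ℤ) :=
  {(p.1 + 1, p.2), (p.1 - 1, p.2), (p.1, p.2 + 1), (p.1, p.2 - 1)}

theorem mem_gridNeighbors {p q : ℤ × ℤ} : q ∈ gridNeighbors p ↔
    q = (p.1 + 1, p.2) ∨ q = (p.1 - 1, p.2) ∨ q = (p.1, p.2 + 1) ∨ q = (p.1, p.2 - 1) := by
  simp [gridNeighbors]

/-- The integer grid graph. -/
def grid : SimpleGraph (ℤ × ℤ) where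
  Adj p q := q ∈ gridNeighbors p
  symm := ⟨by
    intro p q h
    rw [mem_gridNeighbors] at *
    rcases h with rfl | rfl | rfl | rfl <;> simp⟩
  loopless := ⟨by
    intro p h
    rw [mem_gridNeighbors] at h
    simp [Prod.ext_iff] at h
    omega⟩

theorem grid_adj {p q : ℤ × ℤ} : grid.Adj p q ↔ q ∈ gridNeighbors p := Iff.rfl

theorem sum_gridNeighbors {M : Type*} [AddCommMonoid M] (p : ℤ × ℤ) (f : ℤ × ℤ → M) :
    ∑ q ∈ gridNeighbors p, f q =
      f (p.1 + 1, p.2) + (f (p.1 - 1, p.2) + (f (p.1, p.2 + 1) + f (p.1, p.2 - 1))) := by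
  rw [gridNeighbors, Finset.sum_insert, Finset.sum_insert, Finset.sum_pair]
  all_goals simp [Prod.ext_iff]
  all_goals omega

/-- One of the two cells bordering a grid edge; a cell is named by its lower left corner. -/
def cellA (p q : ℤ × ℤ) : ℤ × ℤ := (min p.1 q.1, min p.2 q.2)

/-- The other cell bordering a grid edge. -/
def cellB (p q : ℤ × ℤ) : ℤ × ℤ := (min p.1 q.1 - |p.2 - q.2|, min p.2 q.2 - |p.1 - q.1|)

theorem cellA_comm (p q : ℤ × ℤ) : cellA p q = cellA q p := by
  simp [cellA, min_comm]

theorem cellB_comm (p q : ℤ × ℤ) : cellB p q = cellB q p := by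
  simp [cellB, min_comm, abs_sub_comm]

/-- Each of the four cells around `p` borders exactly two of the four edges at `p`: boundaries of
sets of cells are closed. -/
theorem two_cells_sum (t : ℤ × ℤ → ZMod 2) (p : ℤ × ℤ) :
    ∑ q ∈ gridNeighbors p, (t (cellA p q) + t (cellB p q)) = 0 := by
  rw [sum_gridNeighbors]
  simp only [cellA, cellB]
  have e1 : min p.1 (p.1 + 1) = p.1 := by omega
  have e2 : min p.1 (p.1 - 1) = p.1 - 1 := by omega
  have e3 : min p.2 (p.2 + 1) = p.2 := by omega
  have e4 : min p.2 (p.2 - 1) = p.2 - 1 := by omega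
  simp only [e1, e2, e3, e4, min_self, sub_self, abs_zero, sub_zero,
    sub_add_cancel_left, sub_sub_cancel, abs_neg, abs_one]
  generalize t (p.1, p.2) = a
  generalize t (p.1, p.2 - 1) = b
  generalize t (p.1 - 1, p.2) = c
  generalize t (p.1 - 1, p.2 - 1) = d
  revert a b c d
  decide

/-- A closed chain on the grid that vanishes below some horizontal line is the boundary of a set
of cells. -/
theorem exists_cell_potential (c : ℤ × ℤ → ℤ × ℤ → ZMod 2) (hsymm : ∀ p q, c p q = c q p)
    (N : ℤ) (hN : ∀ p q, p.2 < N → c p q = 0)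
    (hc : ∀ p, ∑ q ∈ gridNeighbors p, c p q = 0) :
    ∃ s : ℤ × ℤ → ZMod 2, ∀ p q, grid.Adj p q → c p q = s (cellA p q) + s (cellB p q) := by
  let h : ℤ → ℤ → ZMod 2 := fun i j => c (i, j) (i + 1, j)
  let w : ℤ → ℤ → ZMod 2 := fun i j => c (i, j) (i, j + 1)
  -- The potential of a cell is the parity of crossings of the chain with a vertical ray going down
  -- from the cell.
  let s : ℤ → ℤ → ZMod 2 := fun i j => ∑ k ∈ Finset.Icc N j, h i k
  have hs0 : ∀ i j, j < N → s i j = 0 := by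
    intro i j hj
    simp only [s]
    rw [Finset.Icc_eq_empty (by omega), Finset.sum_empty]
  have hs1 : ∀ i j, s i j = s i (j - 1) + h i j := by
    intro i j
    by_cases hj : j < N
    · rw [hs0 i j hj, hs0 i (j - 1) (by omega)]
      simp only [h]
      rw [hN _ _ hj, add_zero]
    · simp only [s]
      have : Finset.Icc N j = insert j (Finset.Icc N (j - 1)) := by
        ext k; simp only [Finset.mem_Icc, Finset.mem_insert]; omega
      rw [this, Finset.sum_insert (by simp), add_comm]
  have hclosed : ∀ i j, h i j + h (i - 1) j + w i j + w i (j - 1) = 0 := by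
    intro i j
    have := hc (i, j)
    rw [sum_gridNeighbors] at this
    simp only [h, w, sub_add_cancel]
    rw [hsymm (i - 1, j), hsymm (i, j - 1), ← this]
    simp only [add_assoc]
  -- Horizontal edges are correct by definition of `s`; vertical ones follow by induction upwards,
  -- closedness at each grid point giving the step.
  have hs2 : ∀ i j, s i j + s (i - 1) j = w i j := by
    intro i j
    by_cases hj : j < N
    · rw [hs0 i j hj, hs0 (i - 1) j hj]
      simp only [w]
      rw [hN _ _ hj, add_zero]
    · replace hj : N - 1 ≤ j := by omega
      induction j, hj using Int.leInduction with
      | base =>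
        rw [hs0 _ _ (by omega), hs0 _ _ (by omega)]
        simp only [w]
        rw [hN _ _ (by simp), add_zero]
      | succ j hj ih =>
        rw [hs1 i, hs1 (i - 1)]
        have h1 := hclosed i (j + 1)
        rw [add_sub_cancel_right] at *
        rw [← ih] at h1
        revert h1
        generalize h i (j + 1) = a1
        generalize h (i - 1) (j + 1) = a2
        generalize w i (j + 1) = a3
        generalize s i j = a4
        generalize s (i - 1) j = a5
        revert a1 a2 a3 a4 a5
        decide
  have key : ∀ p q : ℤ × ℤ, (q = (p.1 + 1, p.2) ∨ q = (p.1, p.2 + 1)) →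
      c p q = s (cellA p q).1 (cellA p q).2 + s (cellB p q).1 (cellB p q).2 := by
    rintro ⟨i, j⟩ q (rfl | rfl)
    · have e1 : min i (i + 1) = i := by omega
      simp only [cellA, cellB, e1, min_self, sub_self, abs_zero, sub_zero,
        sub_add_cancel_left, abs_neg, abs_one]
      change h i j = _
      rw [hs1 i j, add_assoc, add_comm (h i j), ← add_assoc]
      generalize s i (j - 1) = a
      generalize h i j = b
      revert a b
      decide
    · have e1 : min j (j + 1) = j := by omega
      simp only [cellA, cellB, e1, min_self, sub_self, abs_zero, sub_zero,
        sub_add_cancel_left, abs_neg, abs_one]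
      exact (hs2 i j).symm
  refine ⟨fun x => s x.1 x.2, fun p q hpq => ?_⟩
  rw [grid_adj, mem_gridNeighbors] at hpq
  rcases hpq with h | h | h | h
  · exact key p q (Or.inl h)
  · rw [hsymm, cellA_comm, cellB_comm]
    exact key q p (Or.inl (by rw [h]; simp))
  · exact key p q (Or.inr h)
  · rw [hsymm, cellA_comm, cellB_comm]
    exact key q p (Or.inr (by rw [h]; simp))

/-- The chain modulo two traced by a walk. -/
def walkChain {a b : ℤ × ℤ} (w : grid.Walk a b) (p q : ℤ × ℤ) : ZMod 2 :=
  (w.edges.count s(p, q) : ℕ)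

theorem walkChain_symm {a b : ℤ × ℤ} (w : grid.Walk a b) (p q : ℤ × ℤ) :
    walkChain w p q = walkChain w q p := by
  rw [walkChain, walkChain, Sym2.eq_swap]

theorem walkChain_boundary {a b : ℤ × ℤ} (w : grid.Walk a b) (p : ℤ × ℤ) :
    ∑ q ∈ gridNeighbors p, walkChain w p q =
      (if p = a then 1 else 0) + (if p = b then 1 else 0) := by
  induction w with
  | nil =>
    simp only [walkChain, SimpleGraph.Walk.edges_nil, List.count_nil, Nat.cast_zero,
      Finset.sum_const_zero]
    split_ifs <;> decide
  | @cons a m b hadj w ih =>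
    have hstep : ∀ q, walkChain (.cons hadj w) p q =
        walkChain w p q + if s(a, m) = s(p, q) then 1 else 0 := by
      intro q
      simp only [walkChain, SimpleGraph.Walk.edges_cons, List.count_cons, Nat.cast_add,
        beq_iff_eq, Nat.cast_ite, Nat.cast_one, Nat.cast_zero]
    have hne : a ≠ m := hadj.ne
    have hone : ∑ q ∈ gridNeighbors p, (if s(a, m) = s(p, q) then (1 : ZMod 2) else 0) =
        (if p = a then 1 else 0) + (if p = m then 1 else 0) := by
      by_cases hpa : p = a
      · subst hpa
        have : ∀ q, s(p, m) = s(p, q) ↔ m = q := by intro q; grind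
        simp only [this, Finset.sum_ite_eq]
        rw [if_pos (grid_adj.1 hadj)]
        simp [hne]
      by_cases hpm : p = m
      · subst hpm
        have : ∀ q, s(a, p) = s(p, q) ↔ a = q := by intro q; grind
        simp only [this, Finset.sum_ite_eq]
        rw [if_pos (grid_adj.1 hadj.symm)]
        simp [hne.symm]
      · rw [Finset.sum_eq_zero]
        · simp [hpa, hpm]
        · intro q _
          rw [if_neg]
          grind
    simp only [hstep, Finset.sum_add_distrib, ih, hone]
    generalize (if p = a then (1 : ZMod 2) else 0) = x
    generalize (if p = m then (1 : ZMod 2) else 0) = y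
    generalize (if p = b then (1 : ZMod 2) else 0) = z
    revert x y z
    decide

theorem walkChain_eq_zero {a b : ℤ × ℤ} (w : grid.Walk a b) {p q : ℤ × ℤ}
    (h : s(p, q) ∉ w.edges) : walkChain w p q = 0 := by
  rw [walkChain, List.count_eq_zero_of_not_mem h, Nat.cast_zero]

/-- Ordered pairs cancel with their swaps. This removes the edges inside a branch set when
boundaries are summed over it. -/
theorem sum_symm_eq_zero {α : Type*} (B : Finset α) (c : α → α → ZMod 2)
    (hsymm : ∀ p q, c p q = c q p) (hdiag : ∀ p, c p p = 0) :
    ∑ p ∈ B, ∑ q ∈ B, c p q = 0 := by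
  rw [← Finset.sum_product']
  refine Finset.sum_involution (fun x _ => (x.2, x.1)) ?_ ?_ ?_ ?_
  · intro x _
    simp only
    rw [hsymm x.2 x.1]
    exact CharTwo.add_self_eq_zero _
  · intro x _ hx heq
    apply hx
    have : x.1 = x.2 := (congrArg Prod.snd heq)
    rw [← this]
    exact hdiag _
  · intro x hx
    rw [Finset.mem_product] at hx ⊢
    exact ⟨hx.2, hx.1⟩
  · intro x _
    rfl

end Grid

/-! ### The cycle space of a finite graph -/

section CycleSpace

variable {V : Type u} [Fintype V]

/-- The boundary map modulo two of a finite graph. -/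
noncomputable def boundary (G : SimpleGraph V) :
    (G.edgeSet → ZMod 2) →ₗ[ZMod 2] (V → ZMod 2) where
  toFun z x := ∑ e : G.edgeSet, if x ∈ (e : Sym2 V) then z e else 0
  map_add' z z' := by
    ext x
    simp only [Pi.add_apply, ← Finset.sum_add_distrib]
    exact Finset.sum_congr rfl fun e _ => by split_ifs <;> simp
  map_smul' a z := by
    ext x
    simp only [Pi.smul_apply, smul_eq_mul, RingHom.id_apply, Finset.mul_sum]
    exact Finset.sum_congr rfl fun e _ => by split_ifs <;> simp

theorem boundary_apply (G : SimpleGraph V) (z : G.edgeSet → ZMod 2) (x : V) :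
    boundary G z x = ∑ e : G.edgeSet, if x ∈ (e : Sym2 V) then z e else 0 := rfl

theorem sum_boundary (G : SimpleGraph V) (z : G.edgeSet → ZMod 2) :
    ∑ x, boundary G z x = 0 := by
  simp only [boundary_apply]
  rw [Finset.sum_comm]
  apply Finset.sum_eq_zero
  rintro ⟨e, he⟩ _
  induction e using Sym2.ind with
  | _ a b =>
    have hab : a ≠ b := (show G.Adj a b from he).ne
    rw [← Finset.sum_filter]
    have : (Finset.univ.filter fun x => x ∈ s(a, b)) = {a, b} := by
      ext x; simp
    rw [this, Finset.sum_pair hab]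
    exact CharTwo.add_self_eq_zero _

/-- Boundaries have coordinate sum zero, so the range is a proper subspace and rank-nullity gains
the extra 1. -/
theorem card_edges_lt_finrank_ker_add [Nonempty V] (G : SimpleGraph V) :
    G.edgeFinset.card + 1 ≤
      Module.finrank (ZMod 2) (LinearMap.ker (boundary G)) + Fintype.card V := by
  have h1 := LinearMap.finrank_range_add_finrank_ker (boundary G)
  have h2 : Module.finrank (ZMod 2) (LinearMap.range (boundary G)) <
      Module.finrank (ZMod 2) (V → ZMod 2) := by
    apply Submodule.finrank_lt
    intro htop
    obtain ⟨x⟩ := ‹Nonempty V›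
    obtain ⟨z, hz⟩ : Pi.single x (1 : ZMod 2) ∈ LinearMap.range (boundary G) := by
      rw [htop]; trivial
    have h := sum_boundary G z
    rw [hz, Finset.sum_pi_single' ] at h
    simp at h
  rw [Module.finrank_fintype_fun_eq_card] at h1 h2
  rw [SimpleGraph.edgeFinset, Set.toFinset_card]
  omega

/-- The set of edges on which a chain does not vanish. -/
noncomputable def chainSupport (G : SimpleGraph V) (z : G.edgeSet → ZMod 2) : Finset (Sym2 V) :=
  (Finset.univ.filter fun e => z e ≠ 0).map (Function.Embedding.subtype _)

theorem mem_chainSupport {G : SimpleGraph V} {z : G.edgeSet → ZMod 2} {e : Sym2 V} :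
    e ∈ chainSupport G z ↔ ∃ h : e ∈ G.edgeSet, z ⟨e, h⟩ ≠ 0 := by
  simp [chainSupport]

theorem chainSupport_injective (G : SimpleGraph V) : Function.Injective (chainSupport G) := by
  intro z z' h
  ext1 ⟨e, he⟩
  have h1 : z ⟨e, he⟩ ≠ 0 ↔ z' ⟨e, he⟩ ≠ 0 := by
    have := congrArg (e ∈ ·) h
    simpa [mem_chainSupport, he] using this
  revert h1
  generalize z ⟨e, he⟩ = a
  generalize z' ⟨e, he⟩ = b
  revert a b
  decide

theorem evenEdges_chainSupport {G : SimpleGraph V} {z : G.edgeSet → ZMod 2}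
    (hz : z ∈ LinearMap.ker (boundary G)) : EvenEdges (chainSupport G z) := by
  intro x
  rw [← ZMod.natCast_eq_zero_iff_even]
  have h := congrFun (LinearMap.mem_ker.1 hz) x
  rw [boundary_apply, Pi.zero_apply] at h
  rw [← h, chainSupport, Finset.filter_map, Finset.card_map, Finset.filter_filter,
    Finset.card_filter, Nat.cast_sum]
  apply Finset.sum_congr rfl
  intro e _
  simp only [Function.comp, Function.Embedding.subtype_apply]
  generalize z e = a
  by_cases hx : x ∈ (e : Sym2 V)
  · simp only [hx, and_true, if_true]
    revert a
    decide
  · simp [hx]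

/-- Extract a linearly independent subfamily with the same span: its members are nonzero, it is at
least as large as the dimension of the cycle space, and passing to a subfamily keeps the covering at
most double. -/
theorem hasDoubleCover_of_spanning [Nonempty V] {G : SimpleGraph V} {ι : Type*}
    (z : ι → G.edgeSet → ZMod 2) (hz : ∀ i, z i ∈ LinearMap.ker (boundary G))
    (hspan : LinearMap.ker (boundary G) ≤ Submodule.span (ZMod 2) (Set.range z))
    (htwo : ∀ e, ∃ i j, ∀ k, z k e ≠ 0 → k = i ∨ k = j) : HasDoubleCover G := by
  obtain ⟨b, hb, hbspan, hli⟩ := exists_linearIndependent (ZMod 2) (Set.range z)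
  have hfin : b.Finite := hli.setFinite
  obtain ⟨b, rfl⟩ := hfin.exists_finset_coe
  have hcard : Module.finrank (ZMod 2) (LinearMap.ker (boundary G)) ≤ b.card := by
    rw [← finrank_span_finset_eq_card (R := ZMod 2) (s := b) hli, hbspan]
    exact Submodule.finrank_mono hspan
  refine ⟨b.image (chainSupport G), ?_, ?_, ?_⟩
  · rw [Finset.card_image_of_injective _ (chainSupport_injective G)]
    have := card_edges_lt_finrank_ker_add G
    omega
  · intro S hS
    obtain ⟨y, hy, rfl⟩ := Finset.mem_image.1 hS
    obtain ⟨i, rfl⟩ := hb hy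
    refine ⟨?_, fun e he => (mem_chainSupport.1 he).1, evenEdges_chainSupport (hz i)⟩
    have hne : z i ≠ 0 := hli.ne_zero (⟨z i, hy⟩ : ((b : Set (G.edgeSet → ZMod 2)) : Type _))
    obtain ⟨e, he⟩ := Function.ne_iff.1 hne
    exact ⟨e, mem_chainSupport.2 ⟨e.2, he⟩⟩
  · intro e
    by_cases he : e ∈ G.edgeSet
    · obtain ⟨i, j, hij⟩ := htwo ⟨e, he⟩
      refine (Finset.card_le_card (t := {chainSupport G (z i), chainSupport G (z j)}) ?_).trans
        Finset.card_le_two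
      intro S hS
      obtain ⟨hS, heS⟩ := Finset.mem_filter.1 hS
      obtain ⟨y, hy, rfl⟩ := Finset.mem_image.1 hS
      obtain ⟨k, rfl⟩ := hb hy
      rcases hij k (mem_chainSupport.1 heS).2 with rfl | rfl <;> simp
    · rw [Finset.filter_eq_empty_iff.2]
      · simp
      · intro S hS heS
        obtain ⟨y, hy, rfl⟩ := Finset.mem_image.1 hS
        exact he (mem_chainSupport.1 heS).1

end CycleSpace

/-! ### From grid models to double covers -/

section Model

variable {V : Type u}

/-- A model of `G` as a minor of the integer grid. -/
structure GridModel (G : SimpleGraph V) where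
  /-- the branch set of a vertex -/
  branch : V → Finset (ℤ × ℤ)
  eq_of_mem : ∀ {x y p}, p ∈ branch x → p ∈ branch y → x = y
  nonempty : ∀ x, (branch x).Nonempty
  linked : ∀ x, ∀ p ∈ branch x, ∀ q ∈ branch x,
    ∃ w : grid.Walk p q, ∀ u ∈ w.support, u ∈ branch x
  touch : ∀ x y, G.Adj x y → ∃ p ∈ branch x, ∃ q ∈ branch y, grid.Adj p q

theorem exists_walk_bound {a b : ℤ × ℤ} (w : grid.Walk a b) :
    ∃ N : ℤ, ∀ p q : ℤ × ℤ, p.2 < N → walkChain w p q = 0 := by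
  obtain ⟨N, hN⟩ := (w.support.toFinset.image Prod.snd).bddBelow
  refine ⟨N, fun p q hp => walkChain_eq_zero w fun h => ?_⟩
  have := hN (Finset.mem_coe.2 (Finset.mem_image_of_mem Prod.snd
    (List.mem_toFinset.2 (w.fst_mem_support_of_mem_edges h))))
  omega

/-- The family consists of the face boundaries of the model. They are cycles because branch sets
contract to vertices; they span because a cycle of `G`, routed through the grid, bounds a union of
faces. -/
theorem GridModel.hasDoubleCover [Fintype V] [Nonempty V] {G : SimpleGraph V}
    (M : GridModel G) : HasDoubleCover G := by
  have hdata : ∀ e : G.edgeSet, ∃ x y p q, (e : Sym2 V) = s(x, y) ∧ p ∈ M.branch x ∧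
      q ∈ M.branch y ∧ grid.Adj p q := by
    rintro ⟨e, he⟩
    induction e using Sym2.ind with
    | _ x y =>
      obtain ⟨p, hp, q, hq, h⟩ := M.touch x y he
      exact ⟨x, y, p, q, rfl, hp, hq, h⟩
  choose hd tl P Q hexy hP hQ hPQ using hdata
  have hne : ∀ e, hd e ≠ tl e := by
    intro e
    have h := e.2
    rw [hexy] at h
    exact (show G.Adj _ _ from h).ne
  have hinj : ∀ e f, s(P e, Q e) = s(P f, Q f) → e = f := by
    intro e f h
    apply Subtype.ext
    rw [hexy e, hexy f]
    rcases Sym2.eq_iff.1 h with ⟨h1, h2⟩ | ⟨h1, h2⟩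
    · rw [M.eq_of_mem (hP e) (h1 ▸ hP f), M.eq_of_mem (hQ e) (h2 ▸ hQ f)]
    · rw [M.eq_of_mem (hP e) (h1 ▸ hQ f), M.eq_of_mem (hQ e) (h2 ▸ hP f), Sym2.eq_swap]
  let inside : ℤ × ℤ → ℤ × ℤ → Prop := fun p q => ∃ x, p ∈ M.branch x ∧ q ∈ M.branch x
  have hnin : ∀ e, ¬ inside (P e) (Q e) := by
    rintro e ⟨x, h1, h2⟩
    exact hne e ((M.eq_of_mem (hP e) h1).trans (M.eq_of_mem (hQ e) h2).symm)
  let kept : ℤ × ℤ → ℤ × ℤ → Prop := fun p q => inside p q ∨ ∃ e, s(P e, Q e) = s(p, q)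
  -- Merging cells across grid edges outside the model makes `Quot r` the set of its faces. `A e`
  -- and `A' e` are the faces on the two sides of `e`.
  let r : ℤ × ℤ → ℤ × ℤ → Prop := fun c c' =>
    ∃ p q, grid.Adj p q ∧ ¬ kept p q ∧ c = cellA p q ∧ c' = cellB p q
  let A : G.edgeSet → Quot r := fun e => Quot.mk r (cellA (P e) (Q e))
  let A' : G.edgeSet → Quot r := fun e => Quot.mk r (cellB (P e) (Q e))
  let z : Quot r → G.edgeSet → ZMod 2 := fun k e =>
    (if A e = k then 1 else 0) + (if A' e = k then 1 else 0)
  refine hasDoubleCover_of_spanning z ?_ ?_ ?_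
  · intro k
    rw [LinearMap.mem_ker]
    ext x
    rw [boundary_apply, Pi.zero_apply, ← Finset.sum_filter]
    let t : ℤ × ℤ → ZMod 2 := fun c => if Quot.mk r c = k then 1 else 0
    let g : ℤ × ℤ → ℤ × ℤ → ZMod 2 := fun p q => t (cellA p q) + t (cellB p q)
    have hg : ∀ p q, g p q = g q p := by
      intro p q
      simp only [g]
      rw [cellA_comm, cellB_comm]
    have htotal : ∑ p ∈ M.branch x, ∑ q ∈ gridNeighbors p, g p q = 0 :=
      Finset.sum_eq_zero fun p _ => two_cells_sum t p
    have hin : ∑ p ∈ M.branch x, ∑ q ∈ gridNeighbors p with q ∈ M.branch x, g p q = 0 := by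
      rw [← sum_symm_eq_zero (M.branch x) (fun p q => if grid.Adj p q then g p q else 0)
        (fun p q => by simp only [grid.adj_comm p q, hg p q]) (fun p => by simp)]
      apply Finset.sum_congr rfl
      intro p _
      rw [← Finset.sum_filter]
      apply Finset.sum_congr _ fun _ _ => rfl
      ext q
      simp only [Finset.mem_filter, grid_adj]
      tauto
    have hout : ∑ p ∈ M.branch x, ∑ q ∈ gridNeighbors p with q ∉ M.branch x, g p q = 0 := by
      have h : ∑ p ∈ M.branch x, ∑ q ∈ gridNeighbors p, g p q =
          ∑ p ∈ M.branch x, ∑ q ∈ gridNeighbors p with q ∈ M.branch x, g p q +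
          ∑ p ∈ M.branch x, ∑ q ∈ gridNeighbors p with q ∉ M.branch x, g p q := by
        rw [← Finset.sum_add_distrib]
        exact Finset.sum_congr rfl fun p _ => (Finset.sum_filter_add_sum_filter_not _ _ _).symm
      rw [htotal, hin, zero_add] at h
      exact h.symm
    rw [← hout, Finset.sum_sigma']
    have hside : ∀ e : G.edgeSet, x ∈ (e : Sym2 V) → hd e = x ∨ hd e ≠ x ∧ tl e = x := by
      intro e he
      rw [hexy e, Sym2.mem_iff] at he
      have := hne e
      grind
    refine Finset.sum_of_injOn (fun e => if hd e = x then ⟨P e, Q e⟩ else ⟨Q e, P e⟩) ?_ ?_ ?_ ?_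
    · intro e _ f _ h
      apply hinj
      simp only at h
      split_ifs at h <;> simp only [Sigma.mk.injEq, heq_eq_eq] at h <;> grind
    · intro e he
      have he' := hside e (Finset.mem_filter.1 (Finset.mem_coe.1 he)).2
      simp only [Finset.coe_sigma, Set.mem_sigma_iff, Finset.mem_coe, Finset.mem_filter]
      rcases he' with h | ⟨h, h'⟩
      · rw [if_pos h]
        refine ⟨h ▸ hP e, hPQ e, fun hq => ?_⟩
        exact hne e (h.trans (M.eq_of_mem hq (hQ e)))
      · rw [if_neg h]
        exact ⟨h' ▸ hQ e, (hPQ e).symm, fun hp => h (M.eq_of_mem (hP e) hp)⟩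
    · rintro ⟨p, q⟩ hpq hnot
      simp only [Finset.mem_sigma, Finset.mem_filter] at hpq
      obtain ⟨hp, hadj, hq⟩ := hpq
      have hk : ¬ kept p q := by
        rintro (⟨y, h1, h2⟩ | ⟨e, he⟩)
        · exact hq (M.eq_of_mem hp h1 ▸ h2)
        · apply hnot
          rcases Sym2.eq_iff.1 he with ⟨h1, h2⟩ | ⟨h1, h2⟩
          · have hx : hd e = x := M.eq_of_mem (hP e) (h1 ▸ hp)
            refine ⟨e, ?_, ?_⟩
            · simp [hexy e, hx]
            · simp only [if_pos hx, h1, h2]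
          · have hx : tl e = x := M.eq_of_mem (hQ e) (h2 ▸ hp)
            refine ⟨e, ?_, ?_⟩
            · simp [hexy e, hx]
            · have hx' : hd e ≠ x := hx ▸ hne e
              simp only [if_neg hx', h1, h2]
      -- An edge leaving the branch set that represents no edge of `G` has the same face on both
      -- sides and contributes zero.
      have hr : Quot.mk r (cellA p q) = Quot.mk r (cellB p q) :=
        Quot.sound ⟨p, q, hadj, hk, rfl, rfl⟩
      simp only [g, t, hr]
      exact CharTwo.add_self_eq_zero _
    · intro e _
      have : z k e = g (P e) (Q e) := rfl
      split_ifs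
      · exact this
      · rw [this, hg]
  · intro y hy
    choose ρ hρ using M.nonempty
    -- Route `e` between the representatives of its ends so that its chosen grid edge is the only
    -- one not inside a branch set.
    have hwalk : ∀ e, ∃ w : grid.Walk (ρ (hd e)) (ρ (tl e)), ∀ p q, ¬ inside p q →
        walkChain w p q = if s(P e, Q e) = s(p, q) then 1 else 0 := by
      intro e
      obtain ⟨w₁, h₁⟩ := M.linked _ _ (hρ (hd e)) _ (hP e)
      obtain ⟨w₂, h₂⟩ := M.linked _ _ (hQ e) _ (hρ (tl e))
      refine ⟨w₁.append (.cons (hPQ e) w₂), fun p q hpq => ?_⟩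
      have c₁ : w₁.edges.count s(p, q) = 0 := List.count_eq_zero_of_not_mem fun h =>
        hpq ⟨_, h₁ _ (w₁.fst_mem_support_of_mem_edges h), h₁ _ (w₁.snd_mem_support_of_mem_edges h)⟩
      have c₂ : w₂.edges.count s(p, q) = 0 := List.count_eq_zero_of_not_mem fun h =>
        hpq ⟨_, h₂ _ (w₂.fst_mem_support_of_mem_edges h), h₂ _ (w₂.snd_mem_support_of_mem_edges h)⟩
      simp only [walkChain, SimpleGraph.Walk.edges_append, SimpleGraph.Walk.edges_cons,
        List.count_append, List.count_cons, c₁, c₂, beq_iff_eq, zero_add, Nat.cast_ite,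
        Nat.cast_one, Nat.cast_zero]
    choose W hW using hwalk
    let c : ℤ × ℤ → ℤ × ℤ → ZMod 2 := fun p q => ∑ e, y e * walkChain (W e) p q
    have hρinj : ∀ a b, ρ a = ρ b → a = b := fun a b h => M.eq_of_mem (hρ a) (h ▸ hρ b)
    have hclosed : ∀ p, ∑ q ∈ gridNeighbors p, c p q = 0 := by
      intro p
      simp only [c]
      rw [Finset.sum_comm]
      simp only [← Finset.mul_sum, walkChain_boundary]
      by_cases hp : ∃ x, p = ρ x
      · obtain ⟨x, rfl⟩ := hp
        have h := congrFun (LinearMap.mem_ker.1 hy) x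
        rw [boundary_apply, Pi.zero_apply] at h
        refine Eq.trans (Finset.sum_congr rfl ?_) h
        intro e _
        have h1 : ρ x = ρ (hd e) ↔ x = hd e := ⟨hρinj _ _, fun h => by rw [h]⟩
        have h2 : ρ x = ρ (tl e) ↔ x = tl e := ⟨hρinj _ _, fun h => by rw [h]⟩
        have := hne e
        rw [hexy e]
        simp only [h1, h2, Sym2.mem_iff]
        by_cases hx : x = hd e
        · simp [hx, this]
        · simp [hx]
      · apply Finset.sum_eq_zero
        intro e _
        rw [if_neg fun h => hp ⟨_, h⟩, if_neg fun h => hp ⟨_, h⟩, add_zero, mul_zero]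
    have hbound : ∃ N : ℤ, ∀ p q, p.2 < N → c p q = 0 := by
      choose N hN using fun e => exists_walk_bound (W e)
      obtain ⟨N₀, hN₀⟩ := (Set.finite_range N).bddBelow
      refine ⟨N₀, fun p q hp => Finset.sum_eq_zero fun e _ => ?_⟩
      rw [hN e p q (lt_of_lt_of_le hp (hN₀ ⟨e, rfl⟩)), mul_zero]
    obtain ⟨N, hN⟩ := hbound
    obtain ⟨s, hs⟩ := exists_cell_potential c
      (fun p q => Finset.sum_congr rfl fun e _ => by rw [walkChain_symm]) N hN hclosed
    -- The routed chain vanishes off the model, so the cell potential is constant on faces.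
    have hsr : ∀ a b, r a b → s a = s b := by
      rintro _ _ ⟨p, q, hadj, hk, rfl, rfl⟩
      have h0 : c p q = 0 := by
        apply Finset.sum_eq_zero
        intro e _
        rw [hW e p q fun h => hk (Or.inl h), if_neg fun h => hk (Or.inr ⟨e, h⟩), mul_zero]
      rw [hs p q hadj] at h0
      exact CharTwo.add_eq_zero.1 h0
    let S : Quot r → ZMod 2 := Quot.lift s hsr
    -- The faces bordering a chosen edge; `z k` is zero for every other `k`.
    let K : Finset (Quot r) := Finset.univ.image A ∪ Finset.univ.image A'
    have hyS : y = ∑ k ∈ K, S k • z k := by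
      ext e
      have hye : y e = S (A e) + S (A' e) := by
        change y e = s (cellA (P e) (Q e)) + s (cellB (P e) (Q e))
        rw [← hs _ _ (hPQ e)]
        simp only [c]
        rw [Finset.sum_eq_single e]
        · rw [hW e _ _ (hnin e), if_pos rfl, mul_one]
        · intro f _ hf
          rw [hW f _ _ (hnin e), if_neg fun h => hf (hinj _ _ h), mul_zero]
        · simp
      have hA : A e ∈ K := Finset.mem_union_left _ (Finset.mem_image_of_mem _ (Finset.mem_univ e))
      have hA' : A' e ∈ K := Finset.mem_union_right _ (Finset.mem_image_of_mem _ (Finset.mem_univ e))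
      rw [hye, Finset.sum_apply]
      simp only [Pi.smul_apply, smul_eq_mul, z, mul_add, Finset.sum_add_distrib, mul_ite, mul_one,
        mul_zero, Finset.sum_ite_eq, if_pos hA, if_pos hA']
    rw [hyS]
    exact Submodule.sum_mem _ fun k _ =>
      Submodule.smul_mem _ _ (Submodule.subset_span ⟨k, rfl⟩)
  · intro e
    refine ⟨A e, A' e, fun k hk => ?_⟩
    by_contra hcon
    apply hk
    simp only [z]
    rw [if_neg fun h => hcon (Or.inl h.symm), if_neg fun h => hcon (Or.inr h.symm), add_zero]

end Model

/-! ### From plane drawings to grid models -/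

section Discretization

/-- Two grid points are joined by a walk inside `S`. -/
def Linked (S : Set (ℤ × ℤ)) (p q : ℤ × ℤ) : Prop :=
  ∃ w : grid.Walk p q, ∀ u ∈ w.support, u ∈ S

theorem Linked.refl {S : Set (ℤ × ℤ)} {p : ℤ × ℤ} (hp : p ∈ S) : Linked S p p :=
  ⟨.nil, by simpa using hp⟩

theorem Linked.symm {S : Set (ℤ × ℤ)} {p q : ℤ × ℤ} (h : Linked S p q) : Linked S q p := by
  obtain ⟨w, hw⟩ := h
  exact ⟨w.reverse, by simpa using hw⟩

theorem Linked.trans {S : Set (ℤ × ℤ)} {p q t : ℤ × ℤ} (h : Linked S p q) (h' : Linked S q t) :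
    Linked S p t := by
  obtain ⟨w, hw⟩ := h
  obtain ⟨w', hw'⟩ := h'
  refine ⟨w.append w', fun u hu => ?_⟩
  rcases (SimpleGraph.Walk.mem_support_append_iff w w').1 hu with h | h
  exacts [hw u h, hw' u h]

theorem Linked.mono {S T : Set (ℤ × ℤ)} (hST : S ⊆ T) {p q : ℤ × ℤ} (h : Linked S p q) :
    Linked T p q := by
  obtain ⟨w, hw⟩ := h
  exact ⟨w, fun u hu => hST (hw u hu)⟩

theorem Linked.of_adj {S : Set (ℤ × ℤ)} {p q : ℤ × ℤ} (hp : p ∈ S) (hq : q ∈ S)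
    (h : grid.Adj p q) : Linked S p q :=
  ⟨.cons h .nil, by simp [hp, hq]⟩

theorem linked_of_abs_fst_le {S : Set (ℤ × ℤ)} {i i' j : ℤ} (hp : (i, j) ∈ S)
    (hq : (i', j) ∈ S) (h : |i' - i| ≤ 1) : Linked S (i, j) (i', j) := by
  rw [abs_le] at h
  have : i' = i ∨ i' = i + 1 ∨ i' = i - 1 := by omega
  rcases this with rfl | rfl | rfl
  · exact .refl hp
  · exact .of_adj hp hq (by simp [grid_adj, mem_gridNeighbors])
  · exact .of_adj hp hq (by simp [grid_adj, mem_gridNeighbors])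

theorem linked_of_abs_snd_le {S : Set (ℤ × ℤ)} {i j j' : ℤ} (hp : (i, j) ∈ S)
    (hq : (i, j') ∈ S) (h : |j' - j| ≤ 1) : Linked S (i, j) (i, j') := by
  rw [abs_le] at h
  have : j' = j ∨ j' = j + 1 ∨ j' = j - 1 := by omega
  rcases this with rfl | rfl | rfl
  · exact .refl hp
  · exact .of_adj hp hq (by simp [grid_adj, mem_gridNeighbors])
  · exact .of_adj hp hq (by simp [grid_adj, mem_gridNeighbors])

theorem linked_Icc {a b p q : ℤ × ℤ} (hp : p ∈ Set.Icc a b) (hq : q ∈ Set.Icc a b) :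
    Linked (Set.Icc a b) p q := by
  have hor : ∀ i i' j : ℤ, i ≤ i' → (i, j) ∈ Set.Icc a b → (i', j) ∈ Set.Icc a b →
      Linked (Set.Icc a b) (i, j) (i', j) := by
    intro i i' j hi
    induction i', hi using Int.leInduction with
    | base => exact fun h _ => .refl h
    | succ k hk ih =>
      intro h h'
      have hmem : (k, j) ∈ Set.Icc a b := by
        simp only [Set.mem_Icc, Prod.le_def] at *
        omega
      exact (ih h hmem).trans (linked_of_abs_fst_le hmem h' (by simp))
  have ver : ∀ i j j' : ℤ, j ≤ j' → (i, j) ∈ Set.Icc a b → (i, j') ∈ Set.Icc a b →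
      Linked (Set.Icc a b) (i, j) (i, j') := by
    intro i j j' hj
    induction j', hj using Int.leInduction with
    | base => exact fun h _ => .refl h
    | succ k hk ih =>
      intro h h'
      have hmem : (i, k) ∈ Set.Icc a b := by
        simp only [Set.mem_Icc, Prod.le_def] at *
        omega
      exact (ih h hmem).trans (linked_of_abs_snd_le hmem h' (by simp))
  obtain ⟨i, j⟩ := p
  obtain ⟨i', j'⟩ := q
  have hmid : (i', j) ∈ Set.Icc a b := by
    simp only [Set.mem_Icc, Prod.le_def] at *
    omega
  have h1 : Linked (Set.Icc a b) (i, j) (i', j) := by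
    rcases le_total i i' with h | h
    exacts [hor i i' j h hp hmid, (hor i' i j h hmid hp).symm]
  have h2 : Linked (Set.Icc a b) (i', j) (i', j') := by
    rcases le_total j j' with h | h
    exacts [ver i' j j' h hmid hq, (ver i' j' j h hq hmid).symm]
  exact h1.trans h2

/-- The part of a walk before it first enters `B`. -/
theorem exists_walk_before {B : Set (ℤ × ℤ)} {a b : ℤ × ℤ} (w : grid.Walk a b) (ha : a ∉ B)
    (hb : b ∈ B) : ∃ c d, ∃ w' : grid.Walk a c, (∀ u ∈ w'.support, u ∈ w.support ∧ u ∉ B) ∧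
      d ∈ B ∧ grid.Adj c d := by
  induction w with
  | nil => exact absurd hb ha
  | @cons a m b hadj w ih =>
    by_cases hm : m ∈ B
    · exact ⟨a, m, .nil, by simp [ha], hm, hadj⟩
    · obtain ⟨c, d, w', hw', hd, hcd⟩ := ih hm hb
      refine ⟨c, d, .cons hadj w', ?_, hd, hcd⟩
      intro u hu
      rw [SimpleGraph.Walk.support_cons, List.mem_cons] at hu ⊢
      rcases hu with rfl | hu
      · exact ⟨Or.inl rfl, ha⟩
      · exact ⟨Or.inr (hw' u hu).1, (hw' u hu).2⟩

/-- The point of the plane with given grid coordinates, for mesh `η`. -/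
def gridPoint (η : ℝ) (p : ℤ × ℤ) : ℝ × ℝ := (η * p.1, η * p.2)

/-- The grid point at the lower left of a point of the plane. -/
noncomputable def roundDown (η : ℝ) (P : ℝ × ℝ) : ℤ × ℤ := (⌊P.1 / η⌋, ⌊P.2 / η⌋)

theorem abs_mul_floor_sub_le {η : ℝ} (hη : 0 < η) (x : ℝ) : |η * ⌊x / η⌋ - x| ≤ η := by
  have h1 := Int.floor_le (x / η)
  have h2 := Int.lt_floor_add_one (x / η)
  rw [le_div_iff₀ hη] at h1
  rw [div_lt_iff₀ hη] at h2
  rw [abs_le]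
  constructor <;> nlinarith

theorem dist_roundDown_le {η : ℝ} (hη : 0 < η) (P : ℝ × ℝ) :
    dist (gridPoint η (roundDown η P)) P ≤ η := by
  rw [Prod.dist_eq, max_le_iff, Real.dist_eq, Real.dist_eq]
  exact ⟨abs_mul_floor_sub_le hη _, abs_mul_floor_sub_le hη _⟩

theorem abs_floor_sub_floor_le {η : ℝ} (hη : 0 < η) {x y : ℝ} (h : |y - x| < η) :
    |⌊y / η⌋ - ⌊x / η⌋| ≤ 1 := by
  rw [abs_lt] at h
  have h1 : y / η < x / η + 1 := by
    rw [← sub_lt_iff_lt_add', ← sub_div, div_lt_one hη]; linarith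
  have h2 : x / η < y / η + 1 := by
    rw [← sub_lt_iff_lt_add', ← sub_div, div_lt_one hη]; linarith
  have h3 := Int.floor_le_floor h1.le
  have h4 := Int.floor_le_floor h2.le
  rw [Int.floor_add_one] at h3 h4
  rw [abs_le]
  omega

/-- The grid points within distance `r` of `P`. -/
noncomputable def gridBox (η r : ℝ) (P : ℝ × ℝ) : Finset (ℤ × ℤ) :=
  Finset.Icc (⌈(P.1 - r) / η⌉, ⌈(P.2 - r) / η⌉) (⌊(P.1 + r) / η⌋, ⌊(P.2 + r) / η⌋)

theorem mem_gridBox {η : ℝ} (hη : 0 < η) {r : ℝ} {P : ℝ × ℝ} {p : ℤ × ℤ} :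
    p ∈ gridBox η r P ↔ dist (gridPoint η p) P ≤ r := by
  rw [Prod.dist_eq, max_le_iff, Real.dist_eq, Real.dist_eq, abs_le, abs_le]
  simp only [gridBox, Finset.mem_Icc, Prod.le_def, Int.ceil_le, Int.le_floor, div_le_iff₀ hη,
    le_div_iff₀ hη, gridPoint]
  constructor
  · rintro ⟨⟨h1, h2⟩, h3, h4⟩
    refine ⟨⟨?_, ?_⟩, ?_, ?_⟩ <;> linarith
  · rintro ⟨⟨h1, h2⟩, h3, h4⟩
    refine ⟨⟨?_, ?_⟩, ?_, ?_⟩ <;> linarith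

theorem linked_gridBox {η r : ℝ} {P : ℝ × ℝ} {p q : ℤ × ℤ} (hp : p ∈ gridBox η r P)
    (hq : q ∈ gridBox η r P) : Linked (gridBox η r P : Set (ℤ × ℤ)) p q := by
  rw [gridBox, Finset.coe_Icc]
  exact linked_Icc (Finset.mem_Icc.1 hp) (Finset.mem_Icc.1 hq)

/-- A curve is followed by a grid walk close to it. -/
theorem linked_roundDown_curve {η : ℝ} (hη : 0 < η) {γ : unitInterval → ℝ × ℝ}
    (hγ : Continuous γ) (t t' : unitInterval) :
    Linked {p | ∃ a ∈ Set.range γ, dist (gridPoint η p) a ≤ 2 * η}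
      (roundDown η (γ t)) (roundDown η (γ t')) := by
  set S : Set (ℤ × ℤ) := {p | ∃ a ∈ Set.range γ, dist (gridPoint η p) a ≤ 2 * η}
  have hsymm : Std.Symm fun t t' => Linked S (roundDown η (γ t)) (roundDown η (γ t')) :=
    ⟨fun _ _ h => h.symm⟩
  refine PreconnectedSpace.induction₂
    (fun t t' => Linked S (roundDown η (γ t)) (roundDown η (γ t'))) ?_
    ⟨fun _ _ _ h h' => h.trans h'⟩ t t'
  intro t
  filter_upwards [Metric.tendsto_nhds.1 (hγ.tendsto t) η hη] with t' ht'
  rw [Prod.dist_eq, max_lt_iff, Real.dist_eq, Real.dist_eq] at ht'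
  have hmem : ∀ t, roundDown η (γ t) ∈ S := fun t =>
    ⟨γ t, ⟨t, rfl⟩, (dist_roundDown_le hη _).trans (by linarith)⟩
  -- Both coordinates may change at once, so the grid walk turns at this corner; hence the tolerance
  -- `2 * η`.
  have hmid : (⌊(γ t').1 / η⌋, ⌊(γ t).2 / η⌋) ∈ S := by
    refine ⟨γ t, ⟨t, rfl⟩, ?_⟩
    rw [Prod.dist_eq, max_le_iff, Real.dist_eq, Real.dist_eq]
    constructor
    · have h1 := abs_mul_floor_sub_le hη (γ t').1
      have h2 := abs_sub_le (η * ⌊(γ t').1 / η⌋) (γ t').1 (γ t).1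
      simp only [gridPoint]
      linarith [ht'.1]
    · have h1 := abs_mul_floor_sub_le hη (γ t).2
      simp only [gridPoint]
      linarith
  exact (linked_of_abs_fst_le (hmem t) hmid (abs_floor_sub_floor_le hη ht'.1)).trans
    (linked_of_abs_snd_le hmid (hmem t') (abs_floor_sub_floor_le hη ht'.2))

/-- Radii for the vertices and a mesh that keep the parts of a drawing apart. -/
theorem exists_scales {V E : Type*} [Finite V] [Finite E] (X : V → ℝ × ℝ)
    (hX : Function.Injective X) (K : E → Set (ℝ × ℝ)) (hK : ∀ e, IsCompact (K e))
    (inc : V → E → Prop) (hinc : ∀ e z, ¬ inc z e → X z ∉ K e)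
    (hKK : ∀ e f, e ≠ f → ∀ p ∈ K e ∩ K f, ∃ x, p = X x) :
    ∃ r η : ℝ, 0 < η ∧ 4 * η ≤ r ∧ (∀ x y, x ≠ y → 2 * r < dist (X x) (X y)) ∧
      (∀ e z, ¬ inc z e → ∀ p ∈ K e, 2 * r < dist p (X z)) ∧
      ∀ e f, e ≠ f → ∀ a ∈ K e, ∀ b ∈ K f, (∀ x, r / 2 ≤ dist a (X x)) →
        (∀ x, r / 2 ≤ dist b (X x)) → 4 * η < dist a b := by
  have small : ∀ c : ℝ, 0 < c → ∀ k : ℝ, 0 < k → ∀ᶠ r in nhdsWithin (0 : ℝ) (Set.Ioi 0),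
      k * r < c := by
    intro c hc k hk
    filter_upwards [Ioo_mem_nhdsGT (div_pos hc hk)] with r hr
    have := hr.2
    rw [lt_div_iff₀ hk] at this
    linarith
  have h1 : ∀ᶠ r in nhdsWithin (0 : ℝ) (Set.Ioi 0),
      ∀ x y, x ≠ y → 2 * r < dist (X x) (X y) := by
    rw [Filter.eventually_all]; intro x
    rw [Filter.eventually_all]; intro y
    by_cases hxy : x = y
    · simp [hxy]
    · filter_upwards [small _ (dist_pos.2 fun h => hxy (hX h)) 2 two_pos] with r hr _ using hr
  have h2 : ∀ᶠ r in nhdsWithin (0 : ℝ) (Set.Ioi 0),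
      ∀ e z, ¬ inc z e → ∀ p ∈ K e, 2 * r < dist p (X z) := by
    rw [Filter.eventually_all]; intro e
    rw [Filter.eventually_all]; intro z
    by_cases hz : inc z e
    · simp [hz]
    · rcases (K e).eq_empty_or_nonempty with h0 | h0
      · simp [h0]
      · have hpos : 0 < Metric.infDist (X z) (K e) :=
          ((hK e).isClosed.notMem_iff_infDist_pos h0).1 (hinc e z hz)
        filter_upwards [small _ hpos 2 two_pos] with r hr _ p hp
        rw [dist_comm]
        exact hr.trans_le (Metric.infDist_le_dist_of_mem hp)
  obtain ⟨r, ⟨hr1, hr2⟩, hr0⟩ := ((h1.and h2).and self_mem_nhdsWithin).exists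
  replace hr0 : 0 < r := hr0
  -- With `r` fixed, the parts of two arcs at distance at least `r / 2` from all vertices are
  -- disjoint compact sets, so they lie a positive distance apart.
  have h3 : ∀ᶠ η in nhdsWithin (0 : ℝ) (Set.Ioi 0),
      ∀ e f, e ≠ f → ∀ a ∈ K e, ∀ b ∈ K f, (∀ x, r / 2 ≤ dist a (X x)) →
        (∀ x, r / 2 ≤ dist b (X x)) → 4 * η < dist a b := by
    rw [Filter.eventually_all]; intro e
    rw [Filter.eventually_all]; intro f
    by_cases hef : e = f
    · simp [hef]
    · let far : Set (ℝ × ℝ) := {a | ∀ x, r / 2 ≤ dist a (X x)}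
      have hfar : IsClosed far := by
        simp only [far, Set.ofPred_forall]
        exact isClosed_iInter fun x => isClosed_le continuous_const (by fun_prop)
      have hdisj : Disjoint (K e ∩ far) (K f ∩ far) := by
        rw [Set.disjoint_left]
        rintro a ⟨hae, hfa⟩ ⟨haf, -⟩
        obtain ⟨x, rfl⟩ := hKK e f hef a ⟨hae, haf⟩
        have := hfa x
        rw [dist_self] at this
        linarith
      obtain ⟨δ, hδ, hd⟩ := hdisj.exists_thickenings ((hK e).inter_right hfar)
        ((hK f).isClosed.inter hfar)
      filter_upwards [small δ hδ 4 (by norm_num)] with η hη _ a ha b hb hfa hfb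
      by_contra! hlt
      refine Set.disjoint_left.1 hd (Metric.self_subset_thickening hδ _ (⟨ha, hfa⟩ : a ∈ K e ∩ far)) ?_
      exact Metric.mem_thickening_iff.2 ⟨b, ⟨hb, hfb⟩, by linarith⟩
  obtain ⟨η, ⟨hη1, hη2⟩, hη0⟩ :=
    ((h3.and (small r hr0 4 (by norm_num))).and self_mem_nhdsWithin).exists
  exact ⟨r, η, hη0, hη2.le, hr1, hr2, hη1⟩

/-- The branch set of `x` is a box around its point together with, for each edge oriented out of
`x`, a grid walk along the arc that stops just before the box of the other end. -/
theorem PlaneDrawing.exists_gridModel {V : Type u} [Finite V] {G : SimpleGraph V}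
    (D : PlaneDrawing G) : Nonempty (GridModel G) := by
  -- In the sup metric of the product, balls are boxes, whose grid points are easily linked.
  let φ : EuclideanSpace ℝ (Fin 2) → ℝ × ℝ := fun p => (p 0, p 1)
  have hφ : Continuous φ := by fun_prop
  have hφinj : Function.Injective φ := by
    intro p q h
    ext i
    fin_cases i
    exacts [congrArg Prod.fst h, congrArg Prod.snd h]
  let X : V → ℝ × ℝ := fun x => φ (D.point x)
  have hdata : ∀ e : G.edgeSet, ∃ x y, (e : Sym2 V) = s(x, y) ∧ ∃ γ : unitInterval → ℝ × ℝ,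
      Continuous γ ∧ γ 0 = X x ∧ γ 1 = X y ∧ Set.range γ = φ '' D.arc e := by
    rintro ⟨e, he⟩
    induction e using Sym2.ind with
    | _ x y =>
      obtain ⟨γ, -, hγ⟩ := D.arc_eq x y he
      refine ⟨x, y, rfl, φ ∘ γ, hφ.comp γ.continuous, ?_, ?_, ?_⟩
      · simp [X]
      · simp [X]
      · rw [Set.range_comp, hγ]
  choose hd tl hexy γ hγ hγ0 hγ1 hγr using hdata
  have hne : ∀ e, hd e ≠ tl e := by
    intro e
    have h := e.2
    rw [hexy] at h
    exact (show G.Adj _ _ from h).ne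
  obtain ⟨r, η, hη, hηr, hXX, hXK, hKK⟩ := exists_scales X
    (fun x y h => D.point_injective (hφinj h)) (fun e : G.edgeSet => Set.range (γ e))
    (fun e => isCompact_range (hγ e)) (fun x e => x ∈ (e : Sym2 V))
    (by
      rintro e z hz hmem
      rw [hγr e] at hmem
      obtain ⟨p, hp, hpz⟩ := hmem
      rw [hφinj hpz] at hp
      exact hz (D.vertex_on_arc e e.2 z hp))
    (by
      rintro e f hef p ⟨hpe, hpf⟩
      rw [hγr] at hpe hpf
      obtain ⟨a, ha, rfl⟩ := hpe
      obtain ⟨b, hb, hab⟩ := hpf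
      rw [hφinj hab] at hb
      obtain ⟨x, -, -, rfl⟩ := D.arc_inter_arc e e.2 f f.2 (fun h => hef (Subtype.ext h)) a ⟨ha, hb⟩
      exact ⟨x, rfl⟩)
  let box : V → Finset (ℤ × ℤ) := fun x => gridBox η r (X x)
  have hbox : ∀ x p, p ∈ box x ↔ dist (gridPoint η p) (X x) ≤ r := fun x p => mem_gridBox hη
  let ctr : V → ℤ × ℤ := fun x => roundDown η (X x)
  have hctr : ∀ x, ctr x ∈ box x := fun x =>
    (hbox x _).2 ((dist_roundDown_le hη _).trans (by linarith))
  have hboxdisj : ∀ x y p, p ∈ box x → p ∈ box y → x = y := by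
    intro x y p hx hy
    by_contra hxy
    rw [hbox] at hx hy
    have := hXX x y hxy
    have := dist_triangle_left (X x) (X y) (gridPoint η p)
    linarith
  have hpre : ∀ e, ∃ c d, ∃ w : grid.Walk (ctr (hd e)) c,
      (∀ u ∈ w.support, (∃ a ∈ Set.range (γ e), dist (gridPoint η u) a ≤ 2 * η) ∧
        u ∉ box (tl e)) ∧ d ∈ box (tl e) ∧ grid.Adj c d := by
    intro e
    have hlink := linked_roundDown_curve hη (hγ e) 0 1
    rw [hγ0, hγ1] at hlink
    obtain ⟨w, hw⟩ := hlink
    obtain ⟨c, d, w', hw', hd', hcd⟩ := exists_walk_before (B := (box (tl e) : Set (ℤ × ℤ))) w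
      (fun h => hne e (hboxdisj _ _ _ (hctr _) h)) (hctr (tl e))
    exact ⟨c, d, w', fun u hu => ⟨hw u (hw' u hu).1, (hw' u hu).2⟩, hd', hcd⟩
  choose c d w hw hdbox hcd using hpre
  have hwbox : ∀ e x, ∀ u ∈ (w e).support, u ∈ box x → hd e = x := by
    intro e x u hu hux
    obtain ⟨⟨a, ha, hau⟩, hnot⟩ := hw e u hu
    by_contra hx
    by_cases htl : tl e = x
    · exact hnot (htl ▸ hux)
    · have hinc : x ∉ (e : Sym2 V) := by
        rw [hexy, Sym2.mem_iff]
        rintro (h | h)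
        exacts [hx h.symm, htl h.symm]
      have h1 := hXK e x hinc a ha
      have h2 := dist_triangle_left a (X x) (gridPoint η u)
      rw [hbox] at hux
      linarith
  -- A common point outside all boxes is within `2 * η` of both arcs, at places at least `r - 2 * η
  -- ≥ r / 2` from every vertex, contradicting their separation by `4 * η`.
  have hww : ∀ e f, ∀ u, u ∈ (w e).support → u ∈ (w f).support → hd e = hd f := by
    intro e f u hue huf
    by_contra hne'
    by_cases hin : ∃ x, u ∈ box x
    · obtain ⟨x, hx⟩ := hin
      exact hne' ((hwbox e x u hue hx).trans (hwbox f x u huf hx).symm)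
    · push Not at hin
      obtain ⟨⟨a, ha, hau⟩, -⟩ := hw e u hue
      obtain ⟨⟨b, hb, hbu⟩, -⟩ := hw f u huf
      have hfar : ∀ a, dist (gridPoint η u) a ≤ 2 * η → ∀ x, r / 2 ≤ dist a (X x) := by
        intro a ha x
        have h1 := hin x
        rw [hbox, not_le] at h1
        have h2 := dist_triangle (gridPoint η u) a (X x)
        linarith
      have h1 := hKK e f (fun h => hne' (by rw [h])) a ha b hb (hfar a hau) (hfar b hbu)
      have h2 := dist_triangle_left a b (gridPoint η u)
      linarith
  have := Fintype.ofFinite V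
  let B : V → Finset (ℤ × ℤ) := fun x =>
    box x ∪ Finset.univ.biUnion fun e => if hd e = x then (w e).support.toFinset else ∅
  have hB : ∀ x p, p ∈ B x ↔ p ∈ box x ∨ ∃ e, hd e = x ∧ p ∈ (w e).support := by
    intro x p
    simp only [B, Finset.mem_union, Finset.mem_biUnion, Finset.mem_univ, true_and]
    refine or_congr Iff.rfl (exists_congr fun e => ?_)
    split_ifs with h <;> simp [h]
  have hlink : ∀ x, ∀ p ∈ B x, Linked (B x : Set (ℤ × ℤ)) (ctr x) p := by
    intro x p hp
    rcases (hB x p).1 hp with h | ⟨e, rfl, h⟩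
    · exact (linked_gridBox (hctr x) h).mono fun u hu => (hB x u).2 (Or.inl hu)
    · exact ⟨(w e).takeUntil p h, fun u hu =>
        (hB _ u).2 (Or.inr ⟨e, rfl, (w e).support_takeUntil_subset_support h hu⟩)⟩
  refine ⟨⟨B, ?_, fun x => ⟨ctr x, (hB x _).2 (Or.inl (hctr x))⟩,
    fun x p hp q hq => (hlink x p hp).symm.trans (hlink x q hq), ?_⟩⟩
  · intro x y p hx hy
    rw [hB] at hx hy
    rcases hx with hx | ⟨e, rfl, hx⟩ <;> rcases hy with hy | ⟨f, rfl, hy⟩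
    · exact hboxdisj x y p hx hy
    · exact (hwbox f x p hy hx).symm
    · exact hwbox e y p hx hy
    · exact hww e f p hx hy
  · intro x y hxy
    let e : G.edgeSet := ⟨s(x, y), hxy⟩
    have he : s(x, y) = s(hd e, tl e) := hexy e
    have hc : c e ∈ B (hd e) := (hB _ _).2 (Or.inr ⟨e, rfl, (w e).end_mem_support⟩)
    have hd' : d e ∈ B (tl e) := (hB _ _).2 (Or.inl (hdbox e))
    rcases Sym2.eq_iff.1 he with ⟨h1, h2⟩ | ⟨h1, h2⟩
    · exact ⟨c e, by rw [h1]; exact hc, d e, by rw [h2]; exact hd', hcd e⟩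
    · exact ⟨d e, by rw [h1]; exact hd', c e, by rw [h2]; exact hc, (hcd e).symm⟩

end Discretization

/-! ### Reducible sets and random colorings -/

section Flexible

variable {V : Type u} {C : Type v}

theorem IsPlanar.induce {G : SimpleGraph V} (h : IsPlanar G) (s : Set V) :
    IsPlanar (G.induce s) := by
  obtain ⟨D⟩ := h
  have hedge : ∀ e ∈ (G.induce s).edgeSet, e.map Subtype.val ∈ G.edgeSet := by
    intro e he
    induction e using Sym2.ind with
    | _ x y => exact he
  refine ⟨⟨fun x => D.point x, fun e => D.arc (e.map Subtype.val), ?_, ?_, ?_, ?_⟩⟩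
  · exact fun x y h => Subtype.ext (D.point_injective h)
  · exact fun x y h => D.arc_eq x y h
  · intro e he x hx
    obtain ⟨y, hy, hxy⟩ := Sym2.mem_map.1 (D.vertex_on_arc _ (hedge e he) x hx)
    rwa [← Subtype.ext hxy]
  · intro e he f hf hef p hp
    obtain ⟨x, hxe, hxf, rfl⟩ := D.arc_inter_arc _ (hedge e he) _ (hedge f hf)
      (fun h => hef (Sym2.map.injective Subtype.val_injective h)) p hp
    obtain ⟨y, hy, rfl⟩ := Sym2.mem_map.1 hxe
    obtain ⟨y', hy', hyy⟩ := Sym2.mem_map.1 hxf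
    rw [Subtype.ext hyy] at hy'
    exact ⟨y, hy, hy', rfl⟩

/-- Planarity and the absence of four-cycles pass to induced subgraphs, so the density argument
applies to every stage of the peeling. -/
theorem IsPlanar.exists_light_configuration [Fintype V] {G : SimpleGraph V} (hP : IsPlanar G)
    (hC : FourCycleFree G) {Z : Finset V} (hZ : Z.Nonempty) :
    (∃ x ∈ Z, (Z.filter (G.Adj x)).card ≤ 3) ∨ ∃ a ∈ Z, ∃ b ∈ Z, ∃ c ∈ Z,
      G.Adj a b ∧ G.Adj a c ∧ G.Adj b c ∧ (Z.filter (G.Adj a)).card = 4 ∧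
        (Z.filter (G.Adj b)).card = 4 ∧ (Z.filter (G.Adj c)).card = 4 := by
  have : Nonempty (Z : Set V) := hZ.to_subtype
  obtain ⟨D⟩ := hP.induce (Z : Set V)
  obtain ⟨M⟩ := D.exists_gridModel
  have hC' := hC.induce (Z : Set V)
  have hdeg : ∀ x : (Z : Set V), (G.induce (Z : Set V)).degree x = (Z.filter (G.Adj x)).card := by
    intro x
    rw [← SimpleGraph.card_neighborFinset_eq_degree,
      ← Finset.card_map (Function.Embedding.subtype _)]
    congr 1
    ext y
    simp only [Finset.mem_map, SimpleGraph.mem_neighborFinset, SimpleGraph.comap_adj,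
      Function.Embedding.subtype_apply, Subtype.exists, Finset.mem_filter]
    exact ⟨fun ⟨y', hy', h, e⟩ => e ▸ ⟨hy', h⟩, fun ⟨hy, h⟩ => ⟨y, hy, h, rfl⟩⟩
  rcases Flexibility.exists_light_configuration hC' (M.hasDoubleCover.edge_bound hC') with
    ⟨x, hx⟩ | ⟨a, b, c, hab, hac, hbc, ha, hb, hc⟩
  · exact Or.inl ⟨x, x.2, hdeg x ▸ hx⟩
  · exact Or.inr ⟨a, a.2, b, b.2, c, c.2, hab, hac, hbc, hdeg a ▸ ha, hdeg b ▸ hb, hdeg c ▸ hc⟩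

/-- The second coloring arises from the first by recoloring `H` so that no conflict between `H` and
`Z` arises. -/
def Recolors (G : SimpleGraph V) (L : V → Finset C) (Z H : Finset V) (ψ ψ' : V → C) : Prop :=
  (∀ u ∉ H, ψ' u = ψ u) ∧ ∀ u ∈ H, ψ' u ∈ L u ∧ ∀ v ∈ Z, G.Adj u v → ψ' u ≠ ψ' v

/-- A reducible set `H ⊆ Z`: colorings of `Z \ H` extend to `H` with the color of one vertex fixed,
and also with one color forbidden at the neighbors in `H` of a vertex outside `Z`. -/
structure Reducible (G : SimpleGraph V) (L : V → Finset C) (Z H : Finset V) : Prop where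
  subset : H ⊆ Z
  nonempty : H.Nonempty
  card_le : H.card ≤ 3
  outer_degree_le : ∀ x ∈ H, ((Z \ H).filter (G.Adj x)).card ≤ 3
  fix : ∀ (ψ : V → C), ∀ x ∈ H, ∀ c ∈ L x, (∀ u ∈ Z \ H, G.Adj x u → ψ u ≠ c) →
    ∃ ψ', Recolors G L Z H ψ ψ' ∧ ψ' x = c
  forbid : ∀ (ψ : V → C) (c : C), ∀ J ⊆ H, (J = ∅ ∨ ∃ y ∉ Z, ∀ u ∈ J, G.Adj y u) →
    ∃ ψ', Recolors G L Z H ψ ψ' ∧ ∀ u ∈ J, ψ' u ≠ c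

/-- The colors of `L x` not used by `ψ` on the neighbors of `x` in `Y`. -/
noncomputable def available (G : SimpleGraph V) (L : V → Finset C) (Y : Finset V) (ψ : V → C)
    (x : V) : Finset C := L x \ (Y.filter (G.Adj x)).image ψ

theorem mem_available {G : SimpleGraph V} {L : V → Finset C} {Y : Finset V} {ψ : V → C} {x : V}
    {c : C} : c ∈ available G L Y ψ x ↔ c ∈ L x ∧ ∀ u ∈ Y, G.Adj x u → ψ u ≠ c := by
  simp [available]

theorem le_card_available {G : SimpleGraph V} {L : V → Finset C} (Y : Finset V) (ψ : V → C)
    (x : V) : (L x).card ≤ (available G L Y ψ x).card + (Y.filter (G.Adj x)).card := by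
  have h1 := Finset.le_card_sdiff ((Y.filter (G.Adj x)).image ψ) (L x)
  have h2 : ((Y.filter (G.Adj x)).image ψ).card ≤ _ := Finset.card_image_le
  rw [available]
  omega

/-- At least 5 - 3 = 2 colors remain available, so one color may be forbidden. -/
theorem reducible_singleton {G : SimpleGraph V} {L : V → Finset C} (hL : ∀ x, (L x).card = 5)
    {Z : Finset V} {x : V} (hx : x ∈ Z) (hd : (Z.filter (G.Adj x)).card ≤ 3) :
    Reducible G L Z {x} := by
  have hout : ((Z \ {x}).filter (G.Adj x)).card ≤ 3 :=
    (Finset.card_le_card (Finset.filter_subset_filter _ Finset.sdiff_subset)).trans hd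
  have hrec : ∀ ψ : V → C, ∀ c ∈ available G L (Z \ {x}) ψ x,
      Recolors G L Z {x} ψ (Function.update ψ x c) := by
    intro ψ c hc
    rw [mem_available] at hc
    refine ⟨fun u hu => Function.update_of_ne (by simpa using hu) _ _, fun u hu => ?_⟩
    rw [Finset.mem_singleton] at hu
    subst hu
    rw [Function.update_self]
    refine ⟨hc.1, fun v hv huv => ?_⟩
    rw [Function.update_of_ne huv.ne']
    exact (hc.2 v (by simp [hv, huv.ne']) huv).symm
  refine ⟨by simpa using hx, by simp, by simp, ?_, ?_, ?_⟩
  · intro y hy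
    rw [Finset.mem_singleton] at hy
    subst hy
    exact hout
  · intro ψ y hy c hc hψ
    rw [Finset.mem_singleton] at hy
    subst hy
    exact ⟨_, hrec ψ c (mem_available.2 ⟨hc, hψ⟩), Function.update_self ..⟩
  · intro ψ c J hJ _
    have h1 := le_card_available (G := G) (L := L) (Z \ {x}) ψ x
    rw [hL] at h1
    obtain ⟨c', hc', hne⟩ := Finset.exists_mem_ne
      (show 1 < (available G L (Z \ {x}) ψ x).card by omega) c
    refine ⟨_, hrec ψ c' hc', fun u hu => ?_⟩
    rw [Finset.mem_singleton.1 (hJ hu), Function.update_self]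
    exact hne

/-- Greedy choice in the order a, b, c, with pairwise distinct colors. -/
theorem exists_triangle_recoloring {G : SimpleGraph V} {L : V → Finset C} {Z : Finset V}
    {a b c : V} (hab : a ≠ b) (hac : a ≠ c) (hbc : b ≠ c) (ψ : V → C) (S : V → Finset C)
    (hS : ∀ u, S u ⊆ available G L (Z \ {a, b, c}) ψ u)
    (ha : 1 ≤ (S a).card) (hb : 2 ≤ (S b).card) (hc : 3 ≤ (S c).card) :
    ∃ ψ', Recolors G L Z {a, b, c} ψ ψ' ∧ ∀ u ∈ ({a, b, c} : Finset V), ψ' u ∈ S u := by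
  obtain ⟨α, hα⟩ := Finset.card_pos.1 ha
  obtain ⟨β, hβ, hβα⟩ := Finset.exists_mem_ne hb α
  obtain ⟨γ, hγ, hγn⟩ := Finset.exists_mem_notMem_of_card_lt_card
    (show ({α, β} : Finset C).card < (S c).card from lt_of_le_of_lt Finset.card_le_two hc)
  simp only [Finset.mem_insert, Finset.mem_singleton, not_or] at hγn
  let ψ' : V → C := fun u => if u = a then α else if u = b then β else if u = c then γ else ψ u
  have ea : ψ' a = α := by simp [ψ']
  have eb : ψ' b = β := by simp [ψ', hab.symm]
  have ec : ψ' c = γ := by simp [ψ', hac.symm, hbc.symm]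
  have eo : ∀ u ∉ ({a, b, c} : Finset V), ψ' u = ψ u := by
    intro u hu
    simp only [Finset.mem_insert, Finset.mem_singleton, not_or] at hu
    simp [ψ', hu]
  have hmem : ∀ u ∈ ({a, b, c} : Finset V), ψ' u ∈ S u := by
    intro u hu
    simp only [Finset.mem_insert, Finset.mem_singleton] at hu
    rcases hu with rfl | rfl | rfl
    · rwa [ea]
    · rwa [eb]
    · rwa [ec]
  refine ⟨ψ', ⟨eo, fun u hu => ?_⟩, hmem⟩
  have h := mem_available.1 (hS u (hmem u hu))
  refine ⟨h.1, fun v hv huv => ?_⟩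
  by_cases hvH : v ∈ ({a, b, c} : Finset V)
  · have hne := huv.ne
    simp only [Finset.mem_insert, Finset.mem_singleton] at hu hvH
    rcases hu with rfl | rfl | rfl <;> rcases hvH with rfl | rfl | rfl <;> grind
  · rw [eo v hvH]
    exact (h.2 v (Finset.mem_sdiff.2 ⟨hv, hvH⟩) huv).symm

/-- Each vertex has two neighbors in the triangle and at most two in the rest of `Z`, hence three
available colors. Fixing one color leaves sizes 1, 3, 3; forbidding a color leaves at worst 2, 2, 3.
Both suffice for the greedy choice. -/
theorem reducible_triangle {G : SimpleGraph V} (hC : FourCycleFree G) {L : V → Finset C}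
    (hL : ∀ x, (L x).card = 5) {Z : Finset V} {a b c : V} (ha : a ∈ Z) (hb : b ∈ Z) (hc : c ∈ Z)
    (hab : G.Adj a b) (hac : G.Adj a c) (hbc : G.Adj b c) (hda : (Z.filter (G.Adj a)).card = 4)
    (hdb : (Z.filter (G.Adj b)).card = 4) (hdc : (Z.filter (G.Adj c)).card = 4) :
    Reducible G L Z {a, b, c} := by
  have n1 := hab.ne
  have n2 := hac.ne
  have n3 := hbc.ne
  have hout : ∀ u ∈ ({a, b, c} : Finset V), ((Z \ {a, b, c}).filter (G.Adj u)).card ≤ 2 := by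
    have key : ∀ u v w, v ∈ Z → w ∈ Z → v ≠ w → G.Adj u v → G.Adj u w →
        (Z.filter (G.Adj u)).card = 4 → v ∈ ({a, b, c} : Finset V) → w ∈ ({a, b, c} : Finset V) →
        ((Z \ {a, b, c}).filter (G.Adj u)).card ≤ 2 := by
      intro u v w hv hw hvw huv huw hd hv' hw'
      have h1 : ((Z \ {a, b, c}).filter (G.Adj u)) ⊆ (Z.filter (G.Adj u)) \ {v, w} := by
        intro y hy
        simp only [Finset.mem_filter, Finset.mem_sdiff] at hy ⊢
        refine ⟨⟨hy.1.1, hy.2⟩, fun h => hy.1.2 ?_⟩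
        rcases Finset.mem_insert.1 h with rfl | h
        · exact hv'
        · exact Finset.mem_singleton.1 h ▸ hw'
      have h2 : ({v, w} : Finset V) ⊆ Z.filter (G.Adj u) := by
        intro y hy
        rcases Finset.mem_insert.1 hy with rfl | hy
        · exact Finset.mem_filter.2 ⟨hv, huv⟩
        · rw [Finset.mem_singleton.1 hy]
          exact Finset.mem_filter.2 ⟨hw, huw⟩
      have h3 := Finset.card_le_card h1
      rw [Finset.card_sdiff_of_subset h2, Finset.card_pair hvw, hd] at h3
      exact h3
    intro u hu
    simp only [Finset.mem_insert, Finset.mem_singleton] at hu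
    rcases hu with rfl | rfl | rfl
    · exact key _ b c hb hc n3 hab hac hda (by simp) (by simp)
    · exact key _ a c ha hc n2 hab.symm hbc hdb (by simp) (by simp)
    · exact key _ a b ha hb n1 hac.symm hbc.symm hdc (by simp) (by simp)
  have hav : ∀ (ψ : V → C), ∀ u ∈ ({a, b, c} : Finset V),
      3 ≤ (available G L (Z \ {a, b, c}) ψ u).card := by
    intro ψ u hu
    have h1 := le_card_available (G := G) (L := L) (Z \ {a, b, c}) ψ u
    have h2 := hout u hu
    rw [hL] at h1
    omega
  have main : ∀ (ψ : V → C) (S : V → Finset C),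
      (∀ u, S u ⊆ available G L (Z \ {a, b, c}) ψ u) →
      (∃ x y z, x ≠ y ∧ x ≠ z ∧ y ≠ z ∧ ({x, y, z} : Finset V) = {a, b, c} ∧
        1 ≤ (S x).card ∧ 2 ≤ (S y).card ∧ 3 ≤ (S z).card) →
      ∃ ψ', Recolors G L Z {a, b, c} ψ ψ' ∧ ∀ u ∈ ({a, b, c} : Finset V), ψ' u ∈ S u := by
    rintro ψ S hS ⟨x, y, z, hxy, hxz, hyz, heq, h1, h2, h3⟩
    rw [← heq] at hS ⊢
    exact exists_triangle_recoloring hxy hxz hyz ψ S hS h1 h2 h3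
  have hperm : ∀ x ∈ ({a, b, c} : Finset V), ∃ y z, x ≠ y ∧ x ≠ z ∧ y ≠ z ∧
      ({x, y, z} : Finset V) = {a, b, c} := by
    intro x hx
    simp only [Finset.mem_insert, Finset.mem_singleton] at hx
    rcases hx with rfl | rfl | rfl
    · exact ⟨b, c, n1, n2, n3, rfl⟩
    · exact ⟨a, c, n1.symm, n3, n2, by grind⟩
    · exact ⟨a, b, n2.symm, n3.symm, n1, by grind⟩
  refine ⟨?_, ⟨a, by simp⟩, Finset.card_le_three, fun x hx => (hout x hx).trans (by norm_num),
    ?_, ?_⟩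
  · intro u hu
    simp only [Finset.mem_insert, Finset.mem_singleton] at hu
    rcases hu with rfl | rfl | rfl <;> assumption
  · intro ψ x hx c' hc' hψ
    obtain ⟨y, z, hxy, hxz, hyz, heq⟩ := hperm x hx
    obtain ⟨ψ', h1, h2⟩ := main ψ
      (fun u => if u = x then {c'} else available G L (Z \ {a, b, c}) ψ u)
      (by
        intro u
        split_ifs with h
        · subst h
          exact Finset.singleton_subset_iff.2 (mem_available.2 ⟨hc', hψ⟩)
        · exact subset_rfl)
      ⟨x, y, z, hxy, hxz, hyz, heq, by simp, by
        rw [if_neg hxy.symm]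
        exact le_trans (by norm_num) (hav ψ y (by simp [← heq])), by
        rw [if_neg hxz.symm]
        exact hav ψ z (by simp [← heq])⟩
    refine ⟨ψ', h1, ?_⟩
    have := h2 x hx
    rw [if_pos rfl] at this
    exact Finset.mem_singleton.1 this
  · intro ψ c' J hJ hJy
    -- An outside vertex adjacent to the whole triangle would close a four-cycle, so some vertex
    -- keeps all three colors and is colored last.
    have hx : ∃ x ∈ ({a, b, c} : Finset V), x ∉ J := by
      by_contra! hall
      rcases hJy with rfl | ⟨y, hyZ, hy⟩
      · exact absurd (hall a (by simp)) (by simp)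
      · exact hC y a b c (fun h => hyZ (h ▸ hb)) n2 (hy a (hall a (by simp))) hab hbc
          (hy c (hall c (by simp))).symm
    obtain ⟨x, hx, hxJ⟩ := hx
    obtain ⟨y, z, hxy, hxz, hyz, heq⟩ := hperm x hx
    let S : V → Finset C := fun u => if u ∈ J then (available G L (Z \ {a, b, c}) ψ u).erase c'
      else available G L (Z \ {a, b, c}) ψ u
    have hS2 : ∀ u ∈ ({a, b, c} : Finset V), 2 ≤ (S u).card := by
      intro u hu
      have h1 := hav ψ u hu
      have h2 := Finset.pred_card_le_card_erase (s := available G L (Z \ {a, b, c}) ψ u) (a := c')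
      simp only [S]
      split_ifs <;> omega
    obtain ⟨ψ', h1, h2⟩ := main ψ S
      (by
        intro u
        simp only [S]
        split_ifs
        · exact Finset.erase_subset _ _
        · exact subset_rfl)
      ⟨y, z, x, hyz, hxy.symm, hxz.symm, by
        rw [← heq]; ext u; simp only [Finset.mem_insert, Finset.mem_singleton]; tauto,
        le_trans (by norm_num) (hS2 y (by simp [← heq])), hS2 z (by simp [← heq]), by
        simp only [S, if_neg hxJ]
        exact hav ψ x hx⟩
    refine ⟨ψ', h1, fun u hu => ?_⟩
    have := h2 u (hJ hu)
    simp only [S, if_pos hu] at this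
    exact Finset.ne_of_mem_erase this

/-- A finite sample of colorings of `Z` in which every color of every list is frequent, and in which
no color is almost always present on up to three common neighbors of a vertex outside `Z`. -/
def HasSample (G : SimpleGraph V) (L : V → Finset C) (Z : Finset V) : Prop :=
  ∃ (Ω : Type) (_ : Fintype Ω) (_ : Nonempty Ω) (φ : Ω → V → C),
    (∀ ω, ∀ x ∈ Z, φ ω x ∈ L x ∧ ∀ y ∈ Z, G.Adj x y → φ ω x ≠ φ ω y) ∧
    (∀ I ⊆ Z, I.card ≤ 3 → (∃ y ∉ Z, ∀ u ∈ I, G.Adj y u) → ∀ c,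
      Fintype.card Ω ≤ 125 ^ I.card * (Finset.univ.filter fun ω => ∀ u ∈ I, φ ω u ≠ c).card) ∧
    ∀ x ∈ Z, ∀ c ∈ L x,
      Fintype.card Ω ≤ 125 ^ 4 * (Finset.univ.filter fun ω => φ ω x = c).card

/-- There are at most 5 ^ 3 recolorings. Listing them with repetitions over `Fin 125` gives a sample
space of uniform size in which each has probability at least 1/125. -/
theorem exists_enumeration_recolors {G : SimpleGraph V} {L : V → Finset C}
    (hL : ∀ x, (L x).card = 5) {Z H : Finset V} (hH : H.card ≤ 3) {ψ : V → C}
    (hne : ∃ ψ', Recolors G L Z H ψ ψ') :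
    ∃ s : Fin 125 → V → C, (∀ i, Recolors G L Z H ψ (s i)) ∧
      ∀ ψ', Recolors G L Z H ψ ψ' → ∃ i, s i = ψ' := by
  let X := {ψ' // Recolors G L Z H ψ ψ'}
  have : Nonempty X := by obtain ⟨ψ', h⟩ := hne; exact ⟨⟨ψ', h⟩⟩
  let T := Fintype.piFinset fun u : H => L u
  let f : X → T := fun ψ' => ⟨fun u => ψ'.1 u, Fintype.mem_piFinset.2 fun u => (ψ'.2.2 u u.2).1⟩
  have hf : Function.Injective f := by
    intro ψ₁ ψ₂ h
    apply Subtype.ext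
    funext u
    by_cases hu : u ∈ H
    · exact congrFun (congrArg Subtype.val h) ⟨u, hu⟩
    · rw [ψ₁.2.1 u hu, ψ₂.2.1 u hu]
  have hT : Fintype.card T ≤ Fintype.card (Fin 125) := by
    rw [Fintype.card_coe, Fintype.card_piFinset]
    simp only [hL, Finset.prod_const, Finset.card_univ, Fintype.card_coe, Fintype.card_fin]
    calc 5 ^ H.card ≤ 5 ^ 3 := Nat.pow_le_pow_right (by norm_num) hH
      _ = 125 := by norm_num
  obtain ⟨g⟩ := Function.Embedding.nonempty_of_card_le hT
  have hsurj := Function.invFun_surjective (g.injective.comp hf)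
  refine ⟨fun i => (Function.invFun (g ∘ f) i).1, fun i => (Function.invFun (g ∘ f) i).2, ?_⟩
  intro ψ' h
  obtain ⟨i, hi⟩ := hsurj ⟨ψ', h⟩
  exact ⟨i, congrArg Subtype.val hi⟩

theorem card_filter_prod_ge {Ω κ : Type*} [Fintype Ω] [Fintype κ] {p : Ω → Prop}
    {q : Ω × κ → Prop} [DecidablePred p] [DecidablePred q] (h : ∀ ω i, p ω → q (ω, i)) :
    Fintype.card κ * (Finset.univ.filter p).card ≤ (Finset.univ.filter q).card := by
  rw [mul_comm, ← Finset.card_univ, ← Finset.card_product]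
  apply Finset.card_le_card
  rintro ⟨ω, i⟩ hω
  rw [Finset.mem_product, Finset.mem_filter] at hω
  exact Finset.mem_filter.2 ⟨Finset.mem_univ _, h ω i hω.1.2⟩

theorem card_filter_le_card_filter_prod {Ω κ : Type*} [Fintype Ω] [Fintype κ] {p : Ω → Prop}
    {q : Ω × κ → Prop} [DecidablePred p] [DecidablePred q] (h : ∀ ω, p ω → ∃ i, q (ω, i)) :
    (Finset.univ.filter p).card ≤ (Finset.univ.filter q).card := by
  refine (Finset.card_le_card ?_).trans (Finset.card_image_le (f := Prod.fst))
  intro ω hω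
  obtain ⟨i, hi⟩ := h ω (Finset.mem_filter.1 hω).2
  exact Finset.mem_image.2 ⟨(ω, i), by simpa using hi, rfl⟩

/-- Events decided on `Z \ H` keep their probability; an event that needs a suitable extension to
`H` loses at most a factor 125. -/
theorem Reducible.hasSample {G : SimpleGraph V} {L : V → Finset C} (hL : ∀ x, (L x).card = 5)
    {Z H : Finset V} (hR : Reducible G L Z H) (hS : HasSample G L (Z \ H)) :
    HasSample G L Z := by
  obtain ⟨Ω, _, _, φ, hφ, hforb, hfix⟩ := hS
  choose s hs hs' using fun ω => exists_enumeration_recolors (Z := Z) hL hR.card_le (ψ := φ ω)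
    -- The color is arbitrary, as it is forbidden nowhere; only the existence of an extension is
    -- needed.
    ((hR.forbid (φ ω) (φ ω hR.nonempty.choose) ∅ (Finset.empty_subset _) (Or.inl rfl)).imp
      fun _ h => h.1)
  have hcard : Fintype.card (Ω × Fin 125) = 125 * Fintype.card Ω := by
    rw [Fintype.card_prod, Fintype.card_fin, mul_comm]
  have hold : ∀ ω i, ∀ x ∉ H, s ω i x = φ ω x := fun ω i x hx => (hs ω i).1 x hx
  refine ⟨Ω × Fin 125, inferInstance, inferInstance, fun a => s a.1 a.2, ?_, ?_, ?_⟩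
  · rintro ⟨ω, i⟩ x hx
    by_cases hxH : x ∈ H
    · exact ⟨((hs ω i).2 x hxH).1, ((hs ω i).2 x hxH).2⟩
    · have hx' : x ∈ Z \ H := Finset.mem_sdiff.2 ⟨hx, hxH⟩
      refine ⟨by simpa only [hold ω i x hxH] using (hφ ω x hx').1, fun y hy hxy => ?_⟩
      by_cases hyH : y ∈ H
      · exact (((hs ω i).2 y hyH).2 x hx hxy.symm).symm
      · simp only [hold ω i x hxH, hold ω i y hyH]
        exact (hφ ω x hx').2 y (Finset.mem_sdiff.2 ⟨hy, hyH⟩) hxy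
  · rintro I hI hI3 ⟨y, hyZ, hy⟩ c
    have hsub : I \ H ⊆ Z \ H := Finset.sdiff_subset_sdiff hI subset_rfl
    have hle : (I \ H).card ≤ I.card := Finset.card_le_card Finset.sdiff_subset
    have hprev := hforb (I \ H) hsub (hle.trans hI3)
      ⟨y, fun h => hyZ (Finset.mem_sdiff.1 h).1, fun u hu => hy u (Finset.mem_sdiff.1 hu).1⟩ c
    rw [hcard]
    by_cases hIH : I ∩ H = ∅
    · have hIH' : I \ H = I := by
        rw [Finset.sdiff_eq_self_iff_disjoint, Finset.disjoint_iff_inter_eq_empty, hIH]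
      rw [hIH'] at hprev
      have h1 := card_filter_prod_ge (κ := Fin 125) (p := fun ω => ∀ u ∈ I, φ ω u ≠ c)
        (q := fun a => ∀ u ∈ I, s a.1 a.2 u ≠ c) (by
          intro ω i h u hu
          have huH : u ∉ H := (Finset.mem_sdiff.1 (hIH'.symm ▸ hu)).2
          simp only [hold ω i u huH]
          exact h u hu)
      rw [Fintype.card_fin] at h1
      calc _ ≤ 125 * (125 ^ I.card * _) := Nat.mul_le_mul_left _ hprev
        _ = 125 ^ I.card * (125 * _) := by ring
        _ ≤ _ := Nat.mul_le_mul_left _ h1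
    -- If `I` meets `H`, the exponent for `I \ H` is smaller by at least one, which pays for the
    -- factor 125.
    · have hlt : (I \ H).card + 1 ≤ I.card := by
        have h1 := Finset.card_sdiff_add_card_inter I H
        have h2 := Finset.card_pos.2 (Finset.nonempty_iff_ne_empty.2 hIH)
        omega
      have h1 := card_filter_le_card_filter_prod (κ := Fin 125)
        (p := fun ω => ∀ u ∈ I \ H, φ ω u ≠ c) (q := fun a => ∀ u ∈ I, s a.1 a.2 u ≠ c) (by
          intro ω h
          obtain ⟨ψ', hψ', hc⟩ := hR.forbid (φ ω) c (I ∩ H) Finset.inter_subset_right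
            (Or.inr ⟨y, hyZ, fun u hu => hy u (Finset.mem_inter.1 hu).1⟩)
          obtain ⟨i, rfl⟩ := hs' ω ψ' hψ'
          refine ⟨i, fun u hu => ?_⟩
          by_cases huH : u ∈ H
          · exact hc u (Finset.mem_inter.2 ⟨hu, huH⟩)
          · simp only [hold ω i u huH]
            exact h u (Finset.mem_sdiff.2 ⟨hu, huH⟩))
      calc _ ≤ 125 * (125 ^ (I \ H).card * _) := Nat.mul_le_mul_left _ hprev
        _ = 125 ^ ((I \ H).card + 1) * _ := by ring
        _ ≤ _ := Nat.mul_le_mul (Nat.pow_le_pow_right (by norm_num) hlt) h1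
  · intro x hx c hc
    rw [hcard]
    by_cases hxH : x ∈ H
    -- The vertex `x` lies outside `Z \ H`, so the avoidance invariant applies to its at most three
    -- neighbors there: 125 ^ 3 for avoiding `c` and one more factor for the extension.
    · let I := (Z \ H).filter (G.Adj x)
      have hI3 : I.card ≤ 3 := hR.outer_degree_le x hxH
      have hprev := hforb I (Finset.filter_subset _ _) hI3
        ⟨x, fun h => (Finset.mem_sdiff.1 h).2 hxH, fun u hu => (Finset.mem_filter.1 hu).2⟩ c
      have h1 := card_filter_le_card_filter_prod (κ := Fin 125)
        (p := fun ω => ∀ u ∈ I, φ ω u ≠ c) (q := fun a => s a.1 a.2 x = c) (by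
          intro ω h
          obtain ⟨ψ', hψ', hxc⟩ := hR.fix (φ ω) x hxH c hc
            fun u hu hxu => h u (Finset.mem_filter.2 ⟨hu, hxu⟩)
          obtain ⟨i, rfl⟩ := hs' ω ψ' hψ'
          exact ⟨i, hxc⟩)
      calc _ ≤ 125 * (125 ^ I.card * _) := Nat.mul_le_mul_left _ hprev
        _ = 125 ^ (I.card + 1) * _ := by ring
        _ ≤ _ := Nat.mul_le_mul (Nat.pow_le_pow_right (by norm_num) (by omega)) h1
    · have hprev := hfix x (Finset.mem_sdiff.2 ⟨hx, hxH⟩) c hc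
      have h1 := card_filter_prod_ge (κ := Fin 125) (p := fun ω => φ ω x = c)
        (q := fun a => s a.1 a.2 x = c) (by
          intro ω i h
          simp only [hold ω i x hxH]
          exact h)
      rw [Fintype.card_fin] at h1
      calc _ ≤ 125 * (125 ^ 4 * _) := Nat.mul_le_mul_left _ hprev
        _ = 125 ^ 4 * (125 * _) := by ring
        _ ≤ _ := Nat.mul_le_mul_left _ h1

theorem hasSample_of_planar [Fintype V] {G : SimpleGraph V} (hP : IsPlanar G)
    (hC : FourCycleFree G) {L : V → Finset C} (hL : ∀ x, (L x).card = 5) (Z : Finset V) :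
    HasSample G L Z := by
  induction Z using Finset.strongInduction with
  | _ Z ih =>
    rcases Z.eq_empty_or_nonempty with rfl | hZ
    · have hne : ∀ x, ∃ c, c ∈ L x := fun x => Finset.card_pos.1 (by rw [hL]; norm_num)
      choose f _ using hne
      refine ⟨Unit, inferInstance, inferInstance, fun _ => f, by simp, ?_, by simp⟩
      intro I hI _ _ c
      rw [Finset.subset_empty.1 hI]
      simp
    · have hred : ∃ H, Reducible G L Z H := by
        rcases hP.exists_light_configuration hC hZ with
          ⟨x, hx, hd⟩ | ⟨a, ha, b, hb, c, hc, hab, hac, hbc, hda, hdb, hdc⟩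
        · exact ⟨_, reducible_singleton hL hx hd⟩
        · exact ⟨_, reducible_triangle hC hL ha hb hc hab hac hbc hda hdb hdc⟩
      obtain ⟨H, hR⟩ := hred
      exact hR.hasSample hL (ih _ (Finset.sdiff_ssubset hR.subset hR.nonempty))

/-- Averaging: the mean weight over the sample is at least `1 / 125 ^ 4` of the total, so some
coloring attains this. -/
theorem HasSample.weightedFlexible [Fintype V] {G : SimpleGraph V} {L : V → Finset C}
    (h : HasSample G L Finset.univ) : WeightedFlexible G L (1 / 125 ^ 4) := by
  obtain ⟨Ω, _, _, φ, hφ, -, hfix⟩ := h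
  intro w hw
  have hsum : ∑ _ω : Ω, (1 / 125 ^ 4 * totalWeight L w) ≤ ∑ ω, ∑ x, w x (φ ω x) := by
    rw [Finset.sum_comm, Finset.sum_const, Finset.card_univ, nsmul_eq_mul, totalWeight,
      Finset.mul_sum, Finset.mul_sum]
    apply Finset.sum_le_sum
    intro x _
    have hfib : ∑ ω, w x (φ ω x) =
        ∑ c ∈ L x, ((Finset.univ.filter fun ω => φ ω x = c).card : ℝ) * w x c := by
      rw [← Finset.sum_fiberwise_of_maps_to (s := Finset.univ) (t := L x) (g := fun ω => φ ω x)
        fun ω _ => (hφ ω x (Finset.mem_univ x)).1]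
      apply Finset.sum_congr rfl
      intro c _
      rw [← nsmul_eq_mul, ← Finset.sum_const]
      apply Finset.sum_congr rfl
      intro ω hω
      rw [(Finset.mem_filter.1 hω).2]
    rw [hfib, Finset.mul_sum, Finset.mul_sum]
    apply Finset.sum_le_sum
    intro c hc
    have h1 : (Fintype.card Ω : ℝ) ≤
        125 ^ 4 * ((Finset.univ.filter fun ω => φ ω x = c).card : ℝ) := by
      exact_mod_cast hfix x (Finset.mem_univ x) c hc
    rw [← mul_assoc]
    apply mul_le_mul_of_nonneg_right _ (hw x c hc)
    rw [mul_one_div, div_le_iff₀ (by positivity), mul_comm]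
    exact h1
  obtain ⟨ω, -, hω⟩ := Finset.exists_le_of_sum_le Finset.univ_nonempty hsum
  exact ⟨φ ω, ⟨fun x y hxy => (hφ ω x (Finset.mem_univ x)).2 y (Finset.mem_univ y) hxy,
    fun x => (hφ ω x (Finset.mem_univ x)).1⟩, hω⟩

end Flexible

end Flexibility

theorem theorem1 :
    ∃ ε : ℝ, 0 < ε ∧
      ∀ (V : Type*) [Fintype V] (C : Type*) (G : SimpleGraph V) (L : V → Finset C),
        Flexibility.IsPlanar G → Flexibility.NoFourCycle G → (∀ x : V, (L x).card = 5) →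
          Flexibility.WeightedFlexible G L ε := by
  refine ⟨1 / 125 ^ 4, by positivity, ?_⟩
  intro V _ C G L hP hC hL
  exact (Flexibility.hasSample_of_planar hP hC.fourCycleFree hL Finset.univ).weightedFlexible
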